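/- Let $(\Omega,\sigma,\mathbb R)$, $\sigma(t,\omega)=\omega\cdot t$, be a minimal continuous flow on a compact metric space. Let $BC$ be the Banach space of bounded continuous functions $x:(-\infty,0]\to\mathbb R^m$ with the supremum norm $\|\cdot\|_\infty$ (maximum norm on $\mathbb R^m$), and let $B_r=\{x\in BC:\|x\|_\infty\le r\}$. For a function $z$ that is continuous on an interval containing $(-\infty,t]$, put $z_t(s)=z(t+s)$, $s\le 0$. Let $D:\Omega\times BC\to\mathbb R^m$ satisfy: (D1) $D(\omega,\cdot)$ is linear and continuous for $\|\cdot\|_\infty$, and $\omega\mapsto D(\omega,\cdot)\in\mathcal L(BC,\mathbb R^m)$ is continuous for the operator norm; (D2) for each $r>0$, $D$ is continuous on $\Omega\times B_r$ when $B_r$ carries the compact-open topology (so that $D(\omega,x)=\int_{-\infty}^0[d\mu(\omega)(s)]\,x(s)$ for a unique matrix $\mu(\omega)$ of finite signed Borel measures on $(-\infty,0]$); (D3) $\mu(\omega)(\{0\})$ is the identity matrix for all $\omega\in\Omega$; (D4) $D$ is stable: there is $c\in C([0,\infty),\mathbb R)$ with $\lim_{t\to\infty}c(t)=0$ such that, whenever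 $D(\omega,\varphi)=0$ with $(\omega,\varphi)\in\Omega\times BC$, the solution of $D(\omega\cdot t,z_t)=0$ for $t\ge0$, $z_0=\varphi$, satisfies $\|z(t)\|\le c(t)\|\varphi\|_\infty$ for all $t\ge 0$. Let $G:\Omega\times BC\to\mathbb R^m$ satisfy: (N1) $G$ is continuous on $\Omega\times BC$ for the norm $\|\cdot\|_\infty$ on $BC$ and, for each $r>0$, Lipschitz continuous in its second variable on $\Omega\times B_r$, with a constant that does not depend on $\omega$; (N2) for each $r>0$, $G$ is continuous on $\Omega\times B_r$ when $B_r$ carries the compact-open topology. Then, for every $\omega\in\Omega$ and every $x\in BC$, the neutral equation $$\frac{d}{dt}D(\omega\cdot t,z_t)=G(\omega\cdot t,z_t),\qquad t\ge 0,$$ locally admits a unique solution $z(\cdot,\omega,x)$ with $z(s,\omega,x)=x(s)$ for $s\le 0$: there is a solution on some $[0,T)$ with $T>0$, and any two solutions with this initial value coincide on their common interval of definition. Put $u(t,\omega,x)=z_t(\cdot,\omega,x)\in BC$ wherever the solution is defined. Then, for each $r\ge 0$, the set of those $(t,\omega,x)\in[0,\infty)\times\Omega\times B_r$ at which $u$ is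 defined is open in $[0,\infty)\times\Omega\times B_r$, and the map $(t,\omega,x)\mapsto(\omega\cdot t,u(t,\omega,x))\in\Omega\times BC$ is continuous on it, when $B_r$ and $BC$ carry the compact-open topology. In other words: if $u(t,\omega,x)$ is defined and $t_n\to t$, $\omega_n\to\omega$, $x_n\to x$ uniformly on compact sets with $x_n,x\in B_r$, then $u(t_n,\omega_n,x_n)$ is defined for all large $n$, $\omega_n\cdot t_n\to\omega\cdot t$, and $u(t_n,\omega_n,x_n)\to u(t,\omega,x)$ uniformly on compact sets. -/

import Mathlib

open Set Filter Topology MeasureTheory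
open scoped NNReal BoundedContinuousFunction

noncomputable section

namespace NeutralFDE

/-- The Banach space of bounded continuous functions from `(-∞, 0]` to `ℝᵐ`, with the supremum
norm; `Fin m → ℝ` carries the maximum norm. -/
abbrev BC (m : ℕ) : Type := Set.Iic (0 : ℝ) →ᵇ (Fin m → ℝ)

/-- The space of all continuous functions from `(-∞, 0]` to `ℝᵐ`; Mathlib equips it with the
compact-open topology. -/
abbrev X (m : ℕ) : Type := C(Set.Iic (0 : ℝ), Fin m → ℝ)

/-- The closed ball of radius `r` (for the supremum norm) in `BC m`. It is deliberately not
reducible to a subtype, because it carries the compact-open topology and not the norm topology. -/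
def Ball (m : ℕ) (r : ℝ) : Type := {x : BC m // ‖x‖ ≤ r}

/-- The restriction of the compact-open topology to the ball. -/
instance (m : ℕ) (r : ℝ) : TopologicalSpace (Ball m r) :=
  TopologicalSpace.induced (fun x : Ball m r => (x.1.toContinuousMap : X m)) inferInstance

/-- The flow is minimal: the only nonempty compact invariant subset is the whole space. -/
def IsMinimalFlow {Ω : Type*} [TopologicalSpace Ω] (σ : Flow ℝ Ω) : Prop :=
  ∀ K : Set Ω, K.Nonempty → IsCompact K → (∀ t : ℝ, σ t '' K = K) → K = Set.univ

open Classical in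
/-- The segment `z_t ∈ BC`, `z_t(s) = z(t + s)` for `s ≤ 0`; it takes the default value `0` if
`s ↦ z(t + s)` is not bounded and continuous on `(-∞, 0]`. -/
def segment {m : ℕ} (z : ℝ → Fin m → ℝ) (t : ℝ) : BC m :=
  if h : ∃ y : BC m, ∀ s : Set.Iic (0 : ℝ), y s = z (t + s) then h.choose else 0

theorem segment_apply {m : ℕ} {z : ℝ → Fin m → ℝ} {t : ℝ}
    (h : ∃ y : BC m, ∀ s : Set.Iic (0 : ℝ), y s = z (t + s)) (s : Set.Iic (0 : ℝ)) :
    segment z t s = z (t + s) := by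
  unfold segment
  rw [dif_pos h]
  exact h.choose_spec s

/-- If `z` is continuous on `(-∞, T)` and extends a function of `BC m`, then all its segments at
times `t < T` are the expected ones. -/
theorem segment_apply_of_continuousOn {m : ℕ} {z : ℝ → Fin m → ℝ} {x : BC m} {T t : ℝ}
    (hz : ContinuousOn z (Set.Iio T)) (hx : ∀ s : Set.Iic (0 : ℝ), z s = x s) (ht : t < T)
    (s : Set.Iic (0 : ℝ)) : segment z t s = z (t + s) := by
  refine segment_apply ?_ s
  have hc : Continuous fun s : Set.Iic (0 : ℝ) => z (t + s) :=
    hz.comp_continuous (by fun_prop) fun s => by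
      have := s.2
      simp only [Set.mem_Iic] at this
      simp only [Set.mem_Iio]
      linarith
  obtain ⟨C, hC⟩ : ∃ C, ∀ y ∈ z '' Set.Icc 0 t, ‖y‖ ≤ C :=
    (isCompact_Icc.image_of_continuousOn
      (hz.mono fun τ hτ => lt_of_le_of_lt hτ.2 ht)).isBounded.exists_norm_le
  refine ⟨BoundedContinuousFunction.ofNormedAddCommGroup _ hc (max C ‖x‖) fun s => ?_,
    fun s => rfl⟩
  rcases le_total (t + s) 0 with h | h
  · have := hx ⟨t + s, h⟩
    simp only at this
    rw [this]
    exact (x.norm_coe_le_norm _).trans (le_max_right _ _)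
  · refine (hC _ ⟨t + s, ⟨h, ?_⟩, rfl⟩).trans (le_max_left _ _)
    have := s.2
    simp only [Set.mem_Iic] at this
    linarith

/-- The matrix `μ` of finite signed Borel measures on `(-∞, 0]` represents the operator `L`:
`L x = ∫ [dμ(s)] x(s)`, that is, the `i`-th coordinate of `L x` is `∑ⱼ ∫ xⱼ dμᵢⱼ`. -/
def IsRepresentingMeasure {m : ℕ} (L : BC m →L[ℝ] (Fin m → ℝ))
    (μ : Matrix (Fin m) (Fin m) (SignedMeasure (Set.Iic (0 : ℝ)))) : Prop :=
  ∀ (x : BC m) (i : Fin m), L x i = ∑ j, ∫ᵛ s, x s j ∂•(μ i j)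

/-- The matrix `μ({0})` of the masses at `0`. -/
def massAtZero {m : ℕ} (μ : Matrix (Fin m) (Fin m) (SignedMeasure (Set.Iic (0 : ℝ)))) :
    Matrix (Fin m) (Fin m) ℝ :=
  Matrix.of fun i j => μ i j {⟨0, Set.mem_Iic.2 le_rfl⟩}

/-- The atomic part at `0` of the operator `L` is the identity matrix. An operator which is
continuous on balls for the compact-open topology has exactly one representing matrix of measures,
so the quantifier refers to that matrix. -/
def AtomicAtZero {m : ℕ} (L : BC m →L[ℝ] (Fin m → ℝ)) : Prop :=
  ∀ μ : Matrix (Fin m) (Fin m) (SignedMeasure (Set.Iic (0 : ℝ))),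
    IsRepresentingMeasure L μ → massAtZero μ = 1

variable {Ω : Type*} [TopologicalSpace Ω] {m : ℕ}

/-- Joint continuity on `Ω × B_r`, for every `r > 0`, with the compact-open topology on `B_r`. -/
def ContinuousOnBalls (H : Ω → BC m → (Fin m → ℝ)) : Prop :=
  ∀ r : ℝ, 0 < r → Continuous fun p : Ω × Ball m r => H p.1 p.2.1

/-- For every `r > 0`, Lipschitz continuity on `B_r` for the supremum norm, uniformly on `Ω`. -/
def LipschitzOnBalls (H : Ω → BC m → (Fin m → ℝ)) : Prop :=
  ∀ r : ℝ, 0 < r → ∃ L : ℝ, ∀ (ω : Ω) (x y : BC m), ‖x‖ ≤ r → ‖y‖ ≤ r →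
    ‖H ω x - H ω y‖ ≤ L * ‖x - y‖

/-- Stability of `D`: the solutions `z` of `D(ω·t, z_t) = 0`, `t ≥ 0`, with `z_0 = φ` satisfy
`‖z(t)‖ ≤ c(t) ‖φ‖` with a continuous function `c`, tending to `0` at infinity, which depends
neither on `ω` nor on `φ`. -/
def IsStable (σ : Flow ℝ Ω) (D : Ω → BC m →L[ℝ] (Fin m → ℝ)) : Prop :=
  ∃ c : ℝ → ℝ, ContinuousOn c (Set.Ici 0) ∧ Tendsto c atTop (𝓝 0) ∧
    ∀ (ω : Ω) (φ : BC m), D ω φ = 0 →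
      ∀ z : ℝ → Fin m → ℝ, Continuous z → (∀ s : Set.Iic (0 : ℝ), z s = φ s) →
        (∀ t : ℝ, 0 ≤ t → D (σ t ω) (segment z t) = 0) →
        ∀ t : ℝ, 0 ≤ t → ‖z t‖ ≤ c t * ‖φ‖

/-- `z` is a solution on `[0, T)` of `d/dt D(ω·t, z_t) = G(ω·t, z_t)` with initial datum `x`
(the derivative at `t = 0` is one-sided). Only the values of `z` on `(-∞, T)` matter. -/
structure IsSolution (σ : Flow ℝ Ω) (D : Ω → BC m →L[ℝ] (Fin m → ℝ))
    (G : Ω → BC m → (Fin m → ℝ)) (ω : Ω) (x : BC m) (T : ℝ) (z : ℝ → Fin m → ℝ) : Prop where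
  pos : 0 < T
  continuousOn : ContinuousOn z (Set.Iio T)
  initial : ∀ s : Set.Iic (0 : ℝ), z s = x s
  hasDeriv : ∀ t ∈ Set.Ico 0 T,
    HasDerivWithinAt (fun τ : ℝ => D (σ τ ω) (segment z τ)) (G (σ t ω) (segment z t))
      (Set.Ici 0) t

/-- The solution with initial datum `x` at `ω` is defined at time `t ≥ 0`. -/
def IsDefinedAt (σ : Flow ℝ Ω) (D : Ω → BC m →L[ℝ] (Fin m → ℝ))
    (G : Ω → BC m → (Fin m → ℝ)) (t : ℝ≥0) (ω : Ω) (x : BC m) : Prop :=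
  ∃ z : ℝ → Fin m → ℝ, ∃ T : ℝ, (t : ℝ) < T ∧ IsSolution σ D G ω x T z

open Classical in
/-- `u(t, ω, x) = z_t(·, ω, x)`, the segment at time `t` of the solution with initial datum `x`
(`0` where that solution is not defined). -/
def solutionSegment (σ : Flow ℝ Ω) (D : Ω → BC m →L[ℝ] (Fin m → ℝ))
    (G : Ω → BC m → (Fin m → ℝ)) (t : ℝ≥0) (ω : Ω) (x : BC m) : BC m :=
  if h : IsDefinedAt σ D G t ω x then segment h.choose t else 0

end NeutralFDE

end

/-! The equation is integrated to D(ω·t, z_t) = D(ω, x) + ∫₀ᵗ G(ω·s, z_s) ds and handled with the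
weight e^{lt}, l large. Everything rests on one estimate: if ‖y(s)‖ ≤ M e^{ls} for s ≤ 0, then ‖y(0)
− D(ω, y)‖ ≤ M/4, for all ω and all large l (`exists_uniform_exp_bound`). Indeed D(ω, ·) is
integration against finite measures with mass 1 at 0; off 0 the integral of e^{ls} tends to 0 as l →
∞, and compactness of Ω makes the bound uniform. The representing measures come from a Riesz theorem
for signed functionals (`exists_finite_measures_of_cutoff`): continuity on balls for the
compact-open topology excludes mass at −∞.

Thus D is the evaluation at 0 up to an error of size 1/4 in the weighted norm, and integrating G
costs L/l ≤ 1/4 more. So the integrated problem is a contraction of ratio 1/2 when G is bounded and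
globally Lipschitz (`exists_global_solution`), and the same two quarters give a stability estimate
for approximate solutions (`norm_sub_le_of_approximate`). This yields uniqueness, and also
continuous dependence: the solution at p₀, with its past replaced by that of p, solves the equation
at p approximately when p is near p₀ (`continuous_solution_family`).

A general G is reduced to this case by clamping its argument. A given solution is bounded up to any
time before the end of its interval, and solutions of the clamped equation from nearby data stay
within 1 of it, so they never meet the clamp and are genuine solutions (`exists_local_family`).
Openness of the domain and continuity of u follow. -/

noncomputable section

namespace NeutralFDE

/-! ### Riesz representation of signed functionals on bounded continuous functions -/

section SignedRiesz

open CompactlySupported CompactlySupportedContinuousMap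

variable {X : Type*} [TopologicalSpace X]

/-- The values of `ℓ` on the bounded continuous functions dominated by `f`. -/
def dominatedValues (ℓ : (X →ᵇ ℝ) →L[ℝ] ℝ) (f : C_c(X, ℝ≥0)) : Set ℝ :=
  ℓ '' {g : X →ᵇ ℝ | ∀ x, |g x| ≤ f x}

/-- The total variation of the functional `ℓ`, on nonnegative functions. -/
def absFunctional (ℓ : (X →ᵇ ℝ) →L[ℝ] ℝ) (f : C_c(X, ℝ≥0)) : ℝ := sSup (dominatedValues ℓ f)

/-- A compactly supported nonnegative function as a bounded continuous real function. -/
def toBCF (f : C_c(X, ℝ≥0)) : X →ᵇ ℝ :=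
  ofCompactSupport (fun x => (f x : ℝ)) (by fun_prop)
    (f.hasCompactSupport.comp_left NNReal.coe_zero)

@[simp] lemma toBCF_apply (f : C_c(X, ℝ≥0)) (x : X) : toBCF f x = f x := rfl

variable (ℓ : (X →ᵇ ℝ) →L[ℝ] ℝ)

lemma le_of_mem_dominatedValues {f : C_c(X, ℝ≥0)} {C : ℝ} (hC : 0 ≤ C) (hf : ∀ x, (f x : ℝ) ≤ C)
    {a : ℝ} (ha : a ∈ dominatedValues ℓ f) : a ≤ ‖ℓ‖ * C := by
  obtain ⟨g, hg, rfl⟩ := ha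
  refine (le_abs_self _).trans ((ℓ.le_opNorm g).trans ?_)
  gcongr
  exact (BoundedContinuousFunction.norm_le hC).2 fun x => (hg x).trans (hf x)

lemma bddAbove_dominatedValues (f : C_c(X, ℝ≥0)) : BddAbove (dominatedValues ℓ f) :=
  ⟨‖ℓ‖ * ‖toBCF f‖, fun _ ha => le_of_mem_dominatedValues ℓ (norm_nonneg _)
    (fun x => (le_abs_self _).trans ((toBCF f).norm_coe_le_norm x)) ha⟩

lemma zero_mem_dominatedValues (f : C_c(X, ℝ≥0)) : (0 : ℝ) ∈ dominatedValues ℓ f :=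
  ⟨0, fun x => by simp, map_zero ℓ⟩

lemma le_absFunctional {f : C_c(X, ℝ≥0)} {g : X →ᵇ ℝ} (hg : ∀ x, |g x| ≤ f x) :
    ℓ g ≤ absFunctional ℓ f :=
  le_csSup (bddAbove_dominatedValues ℓ f) ⟨g, hg, rfl⟩

lemma absFunctional_le {f : C_c(X, ℝ≥0)} {a : ℝ}
    (h : ∀ g : X →ᵇ ℝ, (∀ x, |g x| ≤ f x) → ℓ g ≤ a) : absFunctional ℓ f ≤ a :=
  csSup_le ⟨0, zero_mem_dominatedValues ℓ f⟩ (by rintro _ ⟨g, hg, rfl⟩; exact h g hg)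

lemma absFunctional_nonneg (f : C_c(X, ℝ≥0)) : 0 ≤ absFunctional ℓ f :=
  le_csSup (bddAbove_dominatedValues ℓ f) (zero_mem_dominatedValues ℓ f)

lemma absFunctional_le_of_le {f : C_c(X, ℝ≥0)} {C : ℝ} (hC : 0 ≤ C) (hf : ∀ x, (f x : ℝ) ≤ C) :
    absFunctional ℓ f ≤ ‖ℓ‖ * C :=
  csSup_le ⟨0, zero_mem_dominatedValues ℓ f⟩ fun _ ha => le_of_mem_dominatedValues ℓ hC hf ha

/-- Riesz decomposition: if |g| ≤ f₁ + f₂, clamping g to [−f₁, f₁] leaves a remainder dominated by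
f₂. This makes the variation additive, hence a positive linear functional. -/
lemma absFunctional_add (f₁ f₂ : C_c(X, ℝ≥0)) :
    absFunctional ℓ (f₁ + f₂) = absFunctional ℓ f₁ + absFunctional ℓ f₂ := by
  apply le_antisymm
  · refine absFunctional_le ℓ fun g hg => ?_
    let g₁ : X →ᵇ ℝ := (g ⊓ toBCF f₁) ⊔ (-toBCF f₁)
    have h₁ : ∀ x, |g₁ x| ≤ f₁ x := fun x => by
      simp only [g₁, BoundedContinuousFunction.coe_sup, BoundedContinuousFunction.coe_inf,
        Pi.sup_apply, Pi.inf_apply, BoundedContinuousFunction.coe_neg, Pi.neg_apply, toBCF_apply]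
      rw [abs_le]
      exact ⟨le_sup_right, sup_le inf_le_right (by linarith [(f₁ x).coe_nonneg])⟩
    have h₂ : ∀ x, |(g - g₁) x| ≤ f₂ x := fun x => by
      have h0 := abs_le.1 (hg x)
      have h1 := (f₁ x).coe_nonneg
      have h2 := (f₂ x).coe_nonneg
      simp only [CompactlySupportedContinuousMap.coe_add, Pi.add_apply, NNReal.coe_add] at h0
      simp only [g₁, BoundedContinuousFunction.coe_sub, Pi.sub_apply,
        BoundedContinuousFunction.coe_sup, BoundedContinuousFunction.coe_inf,
        Pi.sup_apply, Pi.inf_apply, BoundedContinuousFunction.coe_neg, Pi.neg_apply, toBCF_apply]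
      rcases le_total (g x) (f₁ x) with h | h
      · rw [inf_of_le_left h]
        rcases le_total (g x) (-f₁ x) with h' | h'
        · rw [sup_of_le_right h', abs_le]; constructor <;> linarith
        · rw [sup_of_le_left h']; simp
      · rw [inf_of_le_right h, sup_of_le_left (by linarith), abs_le]; constructor <;> linarith
    calc ℓ g = ℓ g₁ + ℓ (g - g₁) := by rw [← map_add]; congr 1; abel
      _ ≤ _ := add_le_add (le_absFunctional ℓ h₁) (le_absFunctional ℓ h₂)
  · rw [← le_sub_iff_add_le]
    refine absFunctional_le ℓ fun g₁ h₁ => ?_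
    rw [le_sub_comm]
    refine absFunctional_le ℓ fun g₂ h₂ => ?_
    rw [le_sub_iff_add_le, ← map_add]
    refine le_absFunctional ℓ fun x => ?_
    have := (abs_add_le (g₂ x) (g₁ x)).trans (add_le_add (h₂ x) (h₁ x))
    simpa [add_comm] using this

lemma smul_absFunctional_le (r : ℝ≥0) (f : C_c(X, ℝ≥0)) :
    r * absFunctional ℓ f ≤ absFunctional ℓ (r • f) := by
  rcases eq_or_ne r 0 with rfl | hr
  · simpa using absFunctional_nonneg ℓ _
  have hr' : (0 : ℝ) < r := by positivity
  rw [← le_div_iff₀' hr']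
  refine absFunctional_le ℓ fun g hg => ?_
  rw [le_div_iff₀' hr', ← smul_eq_mul, ← map_smul]
  refine le_absFunctional ℓ fun x => ?_
  simpa [abs_mul] using mul_le_mul_of_nonneg_left (hg x) hr'.le

lemma absFunctional_smul (r : ℝ≥0) (f : C_c(X, ℝ≥0)) :
    absFunctional ℓ (r • f) = r * absFunctional ℓ f := by
  refine le_antisymm ?_ (smul_absFunctional_le ℓ r f)
  rcases eq_or_ne r 0 with rfl | hr
  · refine (absFunctional_le_of_le ℓ le_rfl fun x => by simp).trans (by simp)
  have hr' : (0 : ℝ) < r := by positivity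
  -- The reverse inequality is the proved one for the scalar r⁻¹ and the function r • f.
  have := smul_absFunctional_le ℓ r⁻¹ (r • f)
  rw [smul_smul, inv_mul_cancel₀ hr, one_smul] at this
  rw [NNReal.coe_inv] at this
  field_simp at this
  linarith

lemma apply_toBCF_le_absFunctional (f : C_c(X, ℝ≥0)) : ℓ (toBCF f) ≤ absFunctional ℓ f :=
  le_absFunctional ℓ fun x => by simp

lemma toBCF_add (f g : C_c(X, ℝ≥0)) : toBCF (f + g) = toBCF f + toBCF g := by ext x; simp

lemma toBCF_smul (r : ℝ≥0) (f : C_c(X, ℝ≥0)) : toBCF (r • f) = (r : ℝ) • toBCF f := by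
  ext x; simp

/-- The total variation of `ℓ` as a linear map. -/
def absLinear : C_c(X, ℝ≥0) →ₗ[ℝ≥0] ℝ≥0 where
  toFun f := ⟨absFunctional ℓ f, absFunctional_nonneg ℓ f⟩
  map_add' f g := NNReal.eq (absFunctional_add ℓ f g)
  map_smul' r f := NNReal.eq (absFunctional_smul ℓ r f)

/-- The total variation of `ℓ` minus `ℓ`, as a linear map. -/
def absSubLinear : C_c(X, ℝ≥0) →ₗ[ℝ≥0] ℝ≥0 where
  toFun f := ⟨absFunctional ℓ f - ℓ (toBCF f), sub_nonneg.2 (apply_toBCF_le_absFunctional ℓ f)⟩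
  map_add' f g := NNReal.eq <| by
    change absFunctional ℓ (f + g) - ℓ (toBCF (f + g))
      = (absFunctional ℓ f - ℓ (toBCF f)) + (absFunctional ℓ g - ℓ (toBCF g))
    rw [absFunctional_add, toBCF_add, map_add]; ring
  map_smul' r f := NNReal.eq <| by
    change absFunctional ℓ (r • f) - ℓ (toBCF (r • f)) = r * (absFunctional ℓ f - ℓ (toBCF f))
    rw [absFunctional_smul, toBCF_smul, map_smul, smul_eq_mul, mul_sub]

lemma coe_absLinear (f : C_c(X, ℝ≥0)) : (absLinear ℓ f : ℝ) = absFunctional ℓ f := rfl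

lemma coe_absSubLinear (f : C_c(X, ℝ≥0)) :
    (absSubLinear ℓ f : ℝ) = absFunctional ℓ f - ℓ (toBCF f) := rfl

/-- Take χf⁺ and χf⁻. It carries the representation from nonnegative compactly supported functions
to cut-off bounded ones. -/
lemma toBCF_mul_eq_sub (χ : C_c(X, ℝ≥0)) (f : X →ᵇ ℝ) :
    ∃ g h : C_c(X, ℝ≥0), toBCF χ * f = toBCF g - toBCF h := by
  have hc : ∀ f : X →ᵇ ℝ, Continuous fun x => χ x * (f x).toNNReal := fun f =>
    χ.continuous.mul (continuous_real_toNNReal.comp f.continuous)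
  refine ⟨⟨⟨_, hc f⟩, χ.hasCompactSupport.mul_right⟩,
    ⟨⟨_, hc (-f)⟩, χ.hasCompactSupport.mul_right⟩, ?_⟩
  ext x
  change (χ x : ℝ) * f x = ((χ x * (f x).toNNReal : ℝ≥0) : ℝ) - ((χ x * (-f x).toNNReal : ℝ≥0) : ℝ)
  rw [NNReal.coe_mul, NNReal.coe_mul, ← mul_sub, Real.coe_toNNReal', Real.coe_toNNReal']
  rcases le_total 0 (f x) with h | h
  · rw [max_eq_left h, max_eq_right (by linarith), sub_zero]
  · rw [max_eq_right h, max_eq_left (by linarith), zero_sub, neg_neg]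

variable [T2Space X] [LocallyCompactSpace X] [MeasurableSpace X] [BorelSpace X]

/-- Fatou's lemma along the cutoffs, which converge pointwise to 1 and have integrals Λ(χₙ) ≤ C. -/
lemma isFiniteMeasure_rieszMeasure {Λ : C_c(X, ℝ≥0) →ₗ[ℝ≥0] ℝ≥0} {C : ℝ≥0}
    {χ : ℕ → C_c(X, ℝ≥0)} (hχ : ∀ x, ∀ᶠ n in atTop, χ n x = 1) (hΛ : ∀ n, Λ (χ n) ≤ C) :
    IsFiniteMeasure (NNRealRMK.rieszMeasure Λ) := by
  constructor
  calc NNRealRMK.rieszMeasure Λ univ = ∫⁻ x, 1 ∂(NNRealRMK.rieszMeasure Λ) := by simp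
    _ ≤ ∫⁻ x, liminf (fun n => ((χ n x : ℝ≥0) : ENNReal)) atTop
          ∂(NNRealRMK.rieszMeasure Λ) := by
        refine lintegral_mono fun x => ?_
        have : Tendsto (fun n => ((χ n x : ℝ≥0) : ENNReal)) atTop (𝓝 1) :=
          tendsto_const_nhds.congr' ((hχ x).mono fun n hn => by simp [hn])
        exact this.liminf_eq.ge
    _ ≤ liminf (fun n => ∫⁻ x, ((χ n x : ℝ≥0) : ENNReal) ∂(NNRealRMK.rieszMeasure Λ)) atTop :=
        lintegral_liminf_le fun n => by
          exact (ENNReal.continuous_coe.comp (χ n).continuous).measurable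
    _ ≤ C := by
        refine liminf_le_of_le (by isBoundedDefault) fun b hb => ?_
        obtain ⟨n, hn⟩ := hb.exists
        refine hn.trans ?_
        rw [NNRealRMK.lintegral_rieszMeasure]
        exact_mod_cast hΛ n
    _ < ⊤ := ENNReal.coe_lt_top

/-- A continuous functional on bounded continuous functions which is continuous along cutoffs is
integration against the difference of two finite measures. -/
theorem exists_finite_measures_of_cutoff {χ : ℕ → C_c(X, ℝ≥0)} (hχ1 : ∀ n x, χ n x ≤ 1)
    (hχ : ∀ x, ∀ᶠ n in atTop, χ n x = 1)
    (hℓ : ∀ f : X →ᵇ ℝ, Tendsto (fun n => ℓ (toBCF (χ n) * f)) atTop (𝓝 (ℓ f))) :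
    ∃ μ ν : Measure X, IsFiniteMeasure μ ∧ IsFiniteMeasure ν ∧
      ∀ f : X →ᵇ ℝ, ℓ f = ∫ x, f x ∂μ - ∫ x, f x ∂ν := by
  have hb : ∀ n x, ((χ n x : ℝ≥0) : ℝ) ≤ 1 := fun n x => by exact_mod_cast hχ1 n x
  have hμ : IsFiniteMeasure (NNRealRMK.rieszMeasure (absLinear ℓ)) := by
    refine isFiniteMeasure_rieszMeasure (C := ‖ℓ‖₊) hχ fun n => ?_
    rw [← NNReal.coe_le_coe, coe_absLinear]
    simpa using absFunctional_le_of_le ℓ zero_le_one (hb n)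
  have hν : IsFiniteMeasure (NNRealRMK.rieszMeasure (absSubLinear ℓ)) := by
    refine isFiniteMeasure_rieszMeasure (C := 2 * ‖ℓ‖₊) hχ fun n => ?_
    rw [← NNReal.coe_le_coe, coe_absSubLinear]
    have h1 := absFunctional_le_of_le ℓ zero_le_one (hb n)
    have h2 : -ℓ (toBCF (χ n)) ≤ absFunctional ℓ (χ n) := by
      rw [← map_neg]
      exact le_absFunctional ℓ fun x => by simp
    have : absFunctional ℓ (χ n) - ℓ (toBCF (χ n)) ≤ 2 * ‖ℓ‖ := by linarith
    simpa using this
  refine ⟨_, _, hμ, hν, ?_⟩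
  set μ := NNRealRMK.rieszMeasure (absLinear ℓ)
  set ν := NNRealRMK.rieszMeasure (absSubLinear ℓ)
  -- The decomposition used is ℓ = |ℓ| − (|ℓ| − ℓ), a difference of two positive functionals.
  have key : ∀ f : C_c(X, ℝ≥0), ℓ (toBCF f) = ∫ x, (f x : ℝ) ∂μ - ∫ x, (f x : ℝ) ∂ν := fun f => by
    rw [NNRealRMK.integral_rieszMeasure, NNRealRMK.integral_rieszMeasure]
    rw [coe_absLinear, coe_absSubLinear, sub_sub_cancel]
  have key' : ∀ (f : X →ᵇ ℝ) (n : ℕ), ℓ (toBCF (χ n) * f)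
      = ∫ x, (χ n x : ℝ) * f x ∂μ - ∫ x, (χ n x : ℝ) * f x ∂ν := fun f n => by
    obtain ⟨g, h, hF⟩ := toBCF_mul_eq_sub (χ n) f
    have hI : ∀ (ρ : Measure X) [IsFiniteMeasure ρ], ∫ x, (χ n x : ℝ) * f x ∂ρ
        = ∫ x, (g x : ℝ) ∂ρ - ∫ x, (h x : ℝ) ∂ρ := fun ρ _ => by
      refine Eq.trans ?_ (integral_sub ((toBCF g).integrable ρ) ((toBCF h).integrable ρ))
      exact integral_congr_ae (.of_forall fun x => congr($hF x))
    rw [hF, map_sub, key, key, hI μ, hI ν]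
    ring
  intro f
  have hlim : ∀ (ρ : Measure X) [IsFiniteMeasure ρ],
      Tendsto (fun n => ∫ x, (χ n x : ℝ) * f x ∂ρ) atTop (𝓝 (∫ x, f x ∂ρ)) := fun ρ _ => by
    refine tendsto_integral_of_dominated_convergence (fun x => ‖f x‖)
      (fun n => (toBCF (χ n) * f).integrable ρ |>.aestronglyMeasurable) (f.integrable ρ).norm
      (fun n => .of_forall fun x => ?_) (.of_forall fun x => ?_)
    · rw [norm_mul]
      refine mul_le_of_le_one_left (norm_nonneg _) ?_
      simpa using hχ1 n x
    · exact tendsto_const_nhds.congr' ((hχ x).mono fun n hn => by simp [hn])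
  refine tendsto_nhds_unique (hℓ f) ?_
  simp_rw [key']
  exact (hlim μ).sub (hlim ν)

end SignedRiesz

/-! ### Representing measures of D and the exponential decay estimate -/

section Representation

open CompactlySupported

/-- A continuous cutoff, equal to `1` on `[-n, 0]` and to `0` on `(-∞, -(n + 1)]`. -/
def cutoff (n : ℕ) : C_c(Set.Iic (0 : ℝ), ℝ≥0) where
  toFun s := Real.toNNReal (min 1 (n + 1 + s))
  continuous_toFun := by fun_prop
  hasCompactSupport' := by
    refine HasCompactSupport.intro (K := Subtype.val ⁻¹' Set.Icc (-(n + 1 : ℝ)) 0)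
      ((isClosed_Iic.isClosedEmbedding_subtypeVal).isCompact_preimage isCompact_Icc) fun s hs => ?_
    have h0 : (s : ℝ) ≤ 0 := s.2
    simp only [mem_preimage, mem_Icc, not_and_or, not_le] at hs
    refine Real.toNNReal_of_nonpos ((min_le_right _ _).trans ?_)
    rcases hs with h | h <;> linarith

lemma cutoff_apply (n : ℕ) (s : Set.Iic (0 : ℝ)) :
    cutoff n s = Real.toNNReal (min 1 (n + 1 + s)) := rfl

lemma cutoff_le_one (n : ℕ) (s : Set.Iic (0 : ℝ)) : cutoff n s ≤ 1 := by
  rw [cutoff_apply]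
  exact Real.toNNReal_le_one.2 (min_le_left _ _)

lemma cutoff_eq_one {n : ℕ} {s : Set.Iic (0 : ℝ)} (h : -(n : ℝ) ≤ s) : cutoff n s = 1 := by
  rw [cutoff_apply, min_eq_left (by linarith), Real.toNNReal_one]

lemma eventually_cutoff_eq_one (C : ℝ) :
    ∀ᶠ n : ℕ in atTop, ∀ s : Set.Iic (0 : ℝ), -C ≤ s → cutoff n s = 1 := by
  obtain ⟨N, hN⟩ := exists_nat_ge C
  filter_upwards [eventually_ge_atTop N] with n hn s hs
  have : (N : ℝ) ≤ n := by exact_mod_cast hn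
  exact cutoff_eq_one (by linarith)

variable {m : ℕ}

/-- Continuity on balls of a single operator, for the compact-open topology. -/
def ContinuousOnEachBall (L : BC m → (Fin m → ℝ)) : Prop :=
  ∀ r : ℝ, 0 < r → Continuous fun x : Ball m r => L x.1

/-- A compact subset of (−∞, 0] lies in some [−C, 0], so such a bounded sequence converges in the
compact-open topology. Applied to cutoffs, this is the absence of mass at −∞. -/
lemma tendsto_of_eqOn_compact {L : BC m → (Fin m → ℝ)} (hL : ContinuousOnEachBall L)
    {x : BC m} {y : ℕ → BC m} {R : ℝ} (hy : ∀ n, ‖y n‖ ≤ R) (hx : ‖x‖ ≤ R)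
    (h : ∀ C : ℝ, ∀ᶠ n in atTop, ∀ s : Set.Iic (0 : ℝ), -C ≤ s → y n s = x s) :
    Tendsto (fun n => L (y n)) atTop (𝓝 (L x)) := by
  have hR : 0 < R + 1 := by linarith [(norm_nonneg x).trans hx]
  let y' : ℕ → Ball m (R + 1) := fun n => ⟨y n, (hy n).trans (by linarith)⟩
  let x' : Ball m (R + 1) := ⟨x, hx.trans (by linarith)⟩
  refine ((hL _ hR).tendsto x').comp (f := y') ?_
  rw [nhds_induced, tendsto_comap_iff, ContinuousMap.tendsto_iff_forall_isCompact_tendstoUniformlyOn]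
  intro K hK
  obtain ⟨C, hC⟩ := (hK.image continuous_subtype_val).isBounded.exists_norm_le
  refine tendstoUniformlyOn_iff_tendsto.2 ?_ |>.congr ?_ (F := fun _ => x)
  · exact tendstoUniformlyOn_iff_tendsto.1 fun u hu => .of_forall fun n s _ => refl_mem_uniformity hu
  · filter_upwards [h C] with n hn s hs
    exact (hn s (neg_le_of_abs_le (hC s ⟨s, hs, rfl⟩))).symm

/-- The `j`-th coordinate of an element of `BC m`. -/
def coordBCF (j : Fin m) : BC m →L[ℝ] (Set.Iic (0 : ℝ) →ᵇ ℝ) :=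
  (ContinuousLinearMap.proj (R := ℝ) (φ := fun _ : Fin m => ℝ) j).compLeftContinuousBounded _

/-- The element of `BC m` with `j`-th coordinate `f`, the others being `0`. -/
def singleBCF (j : Fin m) : (Set.Iic (0 : ℝ) →ᵇ ℝ) →L[ℝ] BC m :=
  (ContinuousLinearMap.single ℝ (fun _ : Fin m => ℝ) j).compLeftContinuousBounded _

@[simp] lemma coordBCF_apply (j : Fin m) (x : BC m) (s : Set.Iic (0 : ℝ)) :
    coordBCF j x s = x s j := rfl

@[simp] lemma singleBCF_apply (j : Fin m) (f : Set.Iic (0 : ℝ) →ᵇ ℝ) (s : Set.Iic (0 : ℝ)) :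
    singleBCF j f s = Pi.single j (f s) := rfl

lemma sum_singleBCF_coordBCF (x : BC m) : ∑ j, singleBCF j (coordBCF j x) = x := by
  ext s i
  simp [BoundedContinuousFunction.sum_apply, Finset.sum_apply, Pi.single_apply]

/-- An operator which is continuous on balls for the compact-open topology is represented by a
matrix of differences of finite measures. -/
theorem exists_finite_measures (L : BC m →L[ℝ] (Fin m → ℝ)) (hL : ContinuousOnEachBall L) :
    ∃ μ ν : Fin m → Fin m → Measure (Set.Iic (0 : ℝ)),
      (∀ i j, IsFiniteMeasure (μ i j)) ∧ (∀ i j, IsFiniteMeasure (ν i j)) ∧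
      ∀ (x : BC m) (i : Fin m), L x i = ∑ j, (∫ s, x s j ∂(μ i j) - ∫ s, x s j ∂(ν i j)) := by
  have : LocallyCompactSpace (Set.Iic (0 : ℝ)) := isClosed_Iic.locallyCompactSpace
  have H : ∀ i j, ∃ μ ν : Measure (Set.Iic (0 : ℝ)), IsFiniteMeasure μ ∧ IsFiniteMeasure ν ∧
      ∀ f : Set.Iic (0 : ℝ) →ᵇ ℝ, L (singleBCF j f) i = ∫ s, f s ∂μ - ∫ s, f s ∂ν := fun i j => by
    refine exists_finite_measures_of_cutoff
      ((ContinuousLinearMap.proj (R := ℝ) (φ := fun _ : Fin m => ℝ) i).comp (L.comp (singleBCF j)))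
      cutoff_le_one (fun s => (eventually_cutoff_eq_one (-s)).mono fun n hn => hn s (by simp))
      fun f => ?_
    refine (tendsto_pi_nhds.1 (tendsto_of_eqOn_compact hL (R := ‖(singleBCF j : _ →L[ℝ] BC m)‖ * ‖f‖)
      (fun n => ?_) ((singleBCF j).le_opNorm f) fun C => ?_)) i
    · refine ((singleBCF j).le_opNorm _).trans ?_
      gcongr
      refine (BoundedContinuousFunction.norm_le (norm_nonneg _)).2 fun s => ?_
      rw [BoundedContinuousFunction.mul_apply, norm_mul]
      refine (mul_le_of_le_one_left (norm_nonneg _) ?_).trans (f.norm_coe_le_norm s)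
      simpa using cutoff_le_one n s
    · filter_upwards [eventually_cutoff_eq_one C] with n hn s hs
      simp [hn s hs]
  choose μ ν hμ hν h using H
  refine ⟨μ, ν, hμ, hν, fun x i => ?_⟩
  conv_lhs => rw [← sum_singleBCF_coordBCF x, map_sum, Finset.sum_apply]
  exact Finset.sum_congr rfl fun j _ => h i j _

lemma integral_vectorMeasure_sub {X : Type*} [MeasurableSpace X] (μ ν : Measure X)
    [IsFiniteMeasure μ] [IsFiniteMeasure ν] {f : X → ℝ} (hμ : Integrable f μ)
    (hν : Integrable f ν) :
    (∫ᵛ x, f x ∂•(μ.toSignedMeasure - ν.toSignedMeasure)) = ∫ x, f x ∂μ - ∫ x, f x ∂ν := by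
  have hB : ContinuousLinearMap.lsmul ℝ ℝ = (ContinuousLinearMap.lsmul ℝ ℝ (E := ℝ)).flip := by
    ext; simp
  rw [VectorMeasure.integral_sub_vectorMeasure (by simpa [VectorMeasure.Integrable] using hμ)
    (by simpa [VectorMeasure.Integrable] using hν), hB,
    VectorMeasure.integral_toSignedMeasure, VectorMeasure.integral_toSignedMeasure]

/-- The point `0` of `(-∞, 0]`. -/
abbrev zeroPt : Set.Iic (0 : ℝ) := ⟨0, Set.mem_Iic.2 le_rfl⟩

lemma integral_eq_zero_add {μ : Measure (Set.Iic (0 : ℝ))} [IsFiniteMeasure μ]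
    {f : Set.Iic (0 : ℝ) → ℝ} (hf : Integrable f μ) :
    ∫ s, f s ∂μ = μ.real {zeroPt} * f zeroPt + ∫ s in {zeroPt}ᶜ, f s ∂μ := by
  rw [← integral_add_compl (measurableSet_singleton zeroPt) hf, integral_singleton, smul_eq_mul]

/-- Dominated convergence with majorant 1: e^{ls} → 0 at each s < 0, and only the atom at 0 would
survive. -/
lemma tendsto_integral_exp_compl_zero (μ : Measure (Set.Iic (0 : ℝ))) [IsFiniteMeasure μ] :
    Tendsto (fun l : ℝ => ∫ s in {zeroPt}ᶜ, Real.exp (l * (s : ℝ)) ∂μ) atTop (𝓝 0) := by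
  suffices h : Tendsto (fun l : ℝ => ∫ s in {zeroPt}ᶜ, Real.exp (l * (s : ℝ)) ∂μ) atTop
      (𝓝 (∫ _ in {zeroPt}ᶜ, (0 : ℝ) ∂μ)) by simpa using h
  refine tendsto_integral_filter_of_dominated_convergence (fun _ => 1)
    (.of_forall fun l => (by fun_prop : Continuous fun s : Set.Iic (0 : ℝ) =>
      Real.exp (l * (s : ℝ))).aestronglyMeasurable) ?_ (integrable_const _) ?_
  · filter_upwards [eventually_ge_atTop 0] with l hl
    refine .of_forall fun s => ?_
    rw [Real.norm_eq_abs, Real.abs_exp, Real.exp_le_one_iff]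
    exact mul_nonpos_of_nonneg_of_nonpos hl s.2
  · filter_upwards [ae_restrict_mem (measurableSet_singleton zeroPt).compl] with s hs
    have hs' : (s : ℝ) < 0 := lt_of_le_of_ne s.2 fun h => hs (Subtype.ext h)
    exact Real.tendsto_exp_atBot.comp (tendsto_id.atTop_mul_const_of_neg hs')

lemma abs_setIntegral_le_of_exp_bound (μ : Measure (Set.Iic (0 : ℝ))) [IsFiniteMeasure μ]
    {f : Set.Iic (0 : ℝ) → ℝ} {M l : ℝ} (hl : 0 ≤ l) (A : Set (Set.Iic (0 : ℝ)))
    (hf : ∀ s, |f s| ≤ M * Real.exp (l * (s : ℝ))) :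
    |∫ s in A, f s ∂μ| ≤ M * ∫ s in A, Real.exp (l * (s : ℝ)) ∂μ := by
  rw [← integral_const_mul, ← Real.norm_eq_abs]
  refine norm_integral_le_of_norm_le ?_ (.of_forall fun s => hf s)
  refine Integrable.const_mul ?_ M
  refine Integrable.of_bound (by fun_prop : Continuous fun s : Set.Iic (0 : ℝ) =>
      Real.exp (l * (s : ℝ))).aestronglyMeasurable 1 (.of_forall fun s => ?_)
  rw [Real.norm_eq_abs, Real.abs_exp, Real.exp_le_one_iff]
  exact mul_nonpos_of_nonneg_of_nonpos hl s.2

/-- An operator with atomic part the identity at `0` differs little from the evaluation at `0` on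
functions which decay fast enough at `-∞`. -/
theorem exists_exp_bound_of_atomic (L : BC m →L[ℝ] (Fin m → ℝ)) (hL : ContinuousOnEachBall L)
    (hat : AtomicAtZero L) {ε : ℝ} (hε : 0 < ε) :
    ∀ᶠ l : ℝ in atTop, ∀ (y : BC m) (M : ℝ), (∀ s, ‖y s‖ ≤ M * Real.exp (l * (s : ℝ))) →
      ‖y zeroPt - L y‖ ≤ ε * M := by
  obtain ⟨μ, ν, hμ, hν, h⟩ := exists_finite_measures L hL
  have hint : ∀ (ρ : Measure (Set.Iic (0 : ℝ))) [IsFiniteMeasure ρ] (y : BC m) (j : Fin m),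
      Integrable (fun s => y s j) ρ := fun ρ _ y j => (coordBCF j y).integrable ρ
  have hmass : ∀ i j, (μ i j).real {zeroPt} - (ν i j).real {zeroPt}
      = (1 : Matrix (Fin m) (Fin m) ℝ) i j := fun i j => by
    -- `AtomicAtZero` speaks of every representing matrix, so it says something only once such a
    -- matrix has been exhibited.
    have := hat (Matrix.of fun i j => (μ i j).toSignedMeasure - (ν i j).toSignedMeasure)
      fun y i => by
        rw [h]
        exact Finset.sum_congr rfl fun j _ =>
          (integral_vectorMeasure_sub _ _ (hint _ y j) (hint _ y j)).symm
    rw [← this]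
    simp [massAtZero]
  have hlim : ∀ i, Tendsto (fun l : ℝ => ∑ j, ((∫ s in {zeroPt}ᶜ, Real.exp (l * (s : ℝ)) ∂(μ i j))
      + ∫ s in {zeroPt}ᶜ, Real.exp (l * (s : ℝ)) ∂(ν i j))) atTop (𝓝 0) := fun i => by
    have := tendsto_finsetSum Finset.univ fun j _ =>
      (tendsto_integral_exp_compl_zero (μ i j)).add (tendsto_integral_exp_compl_zero (ν i j))
    simpa using this
  filter_upwards [eventually_ge_atTop 0,
    eventually_all.2 fun i => (hlim i).eventually (gt_mem_nhds hε)] with l hl hl' y M hy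
  have hM : 0 ≤ M := by simpa using (norm_nonneg _).trans (hy zeroPt)
  refine (pi_norm_le_iff_of_nonneg (by positivity)).2 fun i => ?_
  have hc : ∀ j s, |y s j| ≤ M * Real.exp (l * (s : ℝ)) := fun j s =>
    (norm_le_pi_norm (y s) j).trans (hy s)
  -- The identity mass at 0 cancels y(0) exactly; only the integrals off 0 remain.
  have e : (y zeroPt - L y) i = -∑ j, ((∫ s in {zeroPt}ᶜ, y s j ∂(μ i j))
      - ∫ s in {zeroPt}ᶜ, y s j ∂(ν i j)) := by
    have : ∑ j, (1 : Matrix (Fin m) (Fin m) ℝ) i j * y zeroPt j = y zeroPt i := by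
      simp [Matrix.one_apply]
    rw [Pi.sub_apply, h, ← this, ← Finset.sum_sub_distrib, ← Finset.sum_neg_distrib]
    refine Finset.sum_congr rfl fun j _ => ?_
    rw [integral_eq_zero_add (hint (μ i j) y j), integral_eq_zero_add (hint (ν i j) y j), ← hmass]
    ring
  rw [e, norm_neg]
  calc _ ≤ ∑ j, (M * (∫ s in {zeroPt}ᶜ, Real.exp (l * (s : ℝ)) ∂(μ i j))
      + M * ∫ s in {zeroPt}ᶜ, Real.exp (l * (s : ℝ)) ∂(ν i j)) := by
        refine norm_sum_le_of_le _ fun j _ => (norm_sub_le _ _).trans (add_le_add ?_ ?_)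
        · exact abs_setIntegral_le_of_exp_bound _ hl _ (hc j)
        · exact abs_setIntegral_le_of_exp_bound _ hl _ (hc j)
    _ = M * _ := by simp_rw [← mul_add, ← Finset.mul_sum]; rfl
    _ ≤ _ := by rw [mul_comm]; exact mul_le_mul_of_nonneg_right (hl' i).le hM

variable {Ω : Type*} [TopologicalSpace Ω] [CompactSpace Ω]

/-- The bound of `exists_exp_bound_of_atomic` holds uniformly for a continuous family of operators
over a compact space. -/
theorem exists_uniform_exp_bound {D : Ω → BC m →L[ℝ] (Fin m → ℝ)} (hD1 : Continuous D)
    (hD2 : ContinuousOnBalls fun ω x => D ω x) (hD3 : ∀ ω, AtomicAtZero (D ω)) :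
    ∃ l₀ : ℝ, ∀ l ≥ l₀, ∀ (ω : Ω) (y : BC m) (M : ℝ),
      (∀ s, ‖y s‖ ≤ M * Real.exp (l * (s : ℝ))) → ‖y zeroPt - D ω y‖ ≤ M / 4 := by
  have key : ∀ ω₀ : Ω, ∀ᶠ l in atTop, ∀ᶠ ω in 𝓝 ω₀, ∀ (y : BC m) (M : ℝ),
      (∀ s, ‖y s‖ ≤ M * Real.exp (l * (s : ℝ))) → ‖y zeroPt - D ω y‖ ≤ M / 4 := fun ω₀ => by
    have hL : ContinuousOnEachBall (D ω₀) := fun r hr =>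
      (hD2 r hr).comp (by fun_prop : Continuous fun x : Ball m r => (ω₀, x))
    -- The quarter is split: 1/8 for D(ω₀) itself and 1/8 for the operator-norm distance from D(ω)
    -- to D(ω₀).
    filter_upwards [exists_exp_bound_of_atomic (D ω₀) hL (hD3 ω₀) (by norm_num : (0 : ℝ) < 1 / 8),
      eventually_ge_atTop 0] with l hl hl0
    have hball : Metric.ball (D ω₀) (1 / 8) ∈ 𝓝 (D ω₀) :=
      Metric.ball_mem_nhds (D ω₀) (by norm_num : (0 : ℝ) < 1 / 8)
    filter_upwards [hD1.tendsto ω₀ hball] with ω hω y M hy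
    have hM : 0 ≤ M := by simpa using (norm_nonneg _).trans (hy zeroPt)
    have hyM : ‖y‖ ≤ M := (BoundedContinuousFunction.norm_le hM).2 fun s => (hy s).trans
      (mul_le_of_le_one_right hM
        (Real.exp_le_one_iff.2 (mul_nonpos_of_nonneg_of_nonpos hl0 s.2)))
    have h2 : ‖(D ω - D ω₀) y‖ ≤ 1 / 8 * M := ((D ω - D ω₀).le_opNorm y).trans <| by
      gcongr
      exact (mem_ball_iff_norm.1 hω).le
    calc ‖y zeroPt - D ω y‖ = ‖(y zeroPt - D ω₀ y) - (D ω - D ω₀) y‖ := by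
          congr 1; simp
      _ ≤ 1 / 8 * M + 1 / 8 * M := (norm_sub_le _ _).trans (add_le_add (hl y M hy) h2)
      _ = M / 4 := by ring
  choose l hl using fun ω₀ => (key ω₀).exists
  obtain ⟨t, ht⟩ := CompactSpace.elim_nhds_subcover _ hl
  obtain ⟨l₀, hl₀⟩ := (t.image l).bddAbove
  refine ⟨l₀, fun l' hl' ω y M hy => ?_⟩
  obtain ⟨ω₀, hω₀, hω⟩ : ∃ ω₀ ∈ t, ω ∈ _ := by
    have : ω ∈ (⊤ : Set Ω) := trivial
    rw [← ht] at this
    simpa only [mem_iUnion, exists_prop] using this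
  have hM : 0 ≤ M := by simpa using (norm_nonneg _).trans (hy zeroPt)
  refine hω y M fun s => (hy s).trans ?_
  -- On s ≤ 0 decay at rate l' implies decay at any smaller rate, so one l₀ serves the whole finite
  -- subcover.
  have h1 : l ω₀ ≤ l' := (hl₀ (Finset.mem_coe.2 (Finset.mem_image_of_mem _ hω₀))).trans hl'
  gcongr M * Real.exp ?_
  exact mul_le_mul_of_nonpos_right h1 s.2

end Representation

/-! ### Segments of functions on the line and continuity of D and G along them -/

section Segments

variable {m : ℕ}

/-- Continuous functions which are bounded on every left half-line. -/
structure Admissible (z : ℝ → Fin m → ℝ) : Prop where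
  continuous : Continuous z
  bounded : ∀ t, ∃ C, ∀ s ≤ t, ‖z s‖ ≤ C

lemma Admissible.add {z w : ℝ → Fin m → ℝ} (hz : Admissible z) (hw : Admissible w) :
    Admissible (fun t => z t + w t) where
  continuous := hz.continuous.add hw.continuous
  bounded t := by
    obtain ⟨C, hC⟩ := hz.bounded t
    obtain ⟨C', hC'⟩ := hw.bounded t
    exact ⟨C + C', fun s hs => norm_add_le_of_le (hC s hs) (hC' s hs)⟩

lemma Admissible.sub {z w : ℝ → Fin m → ℝ} (hz : Admissible z) (hw : Admissible w) :
    Admissible (fun t => z t - w t) where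
  continuous := hz.continuous.sub hw.continuous
  bounded t := by
    obtain ⟨C, hC⟩ := hz.bounded t
    obtain ⟨C', hC'⟩ := hw.bounded t
    exact ⟨C + C', fun s hs => norm_sub_le_of_le (hC s hs) (hC' s hs)⟩

lemma Admissible.segment_apply {z : ℝ → Fin m → ℝ} (hz : Admissible z) (t : ℝ)
    (s : Set.Iic (0 : ℝ)) : segment z t s = z (t + s) := by
  obtain ⟨C, hC⟩ := hz.bounded t
  exact NeutralFDE.segment_apply ⟨BoundedContinuousFunction.ofNormedAddCommGroup
    (fun s : Set.Iic (0 : ℝ) => z (t + s))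
    (hz.continuous.comp (by fun_prop)) C fun s => hC _ (add_le_of_nonpos_right s.2), fun _ => rfl⟩ s

lemma Admissible.segment_zeroPt {z : ℝ → Fin m → ℝ} (hz : Admissible z) (t : ℝ) :
    segment z t zeroPt = z t := by
  rw [hz.segment_apply, add_zero]

lemma Admissible.segment_add {z w : ℝ → Fin m → ℝ} (hz : Admissible z) (hw : Admissible w) (t : ℝ) :
    segment (fun t => z t + w t) t = segment z t + segment w t := by
  ext s : 1
  rw [(hz.add hw).segment_apply, BoundedContinuousFunction.add_apply, hz.segment_apply,
    hw.segment_apply]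

lemma Admissible.segment_sub {z w : ℝ → Fin m → ℝ} (hz : Admissible z) (hw : Admissible w) (t : ℝ) :
    segment (fun t => z t - w t) t = segment z t - segment w t := by
  ext s : 1
  rw [(hz.sub hw).segment_apply, BoundedContinuousFunction.sub_apply, hz.segment_apply,
    hw.segment_apply]

lemma segment_congr {z w : ℝ → Fin m → ℝ} {t : ℝ} (h : ∀ s ≤ t, z s = w s) :
    segment z t = segment w t := by
  have e : ∀ y : BC m, (∀ s : Set.Iic (0 : ℝ), y s = z (t + s))
      ↔ ∀ s : Set.Iic (0 : ℝ), y s = w (t + s) := fun y =>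
    forall_congr' fun s => by rw [h _ (add_le_of_nonpos_right s.2)]
  by_cases hz : ∃ y : BC m, ∀ s : Set.Iic (0 : ℝ), y s = z (t + s)
  · ext s : 1
    rw [segment_apply hz, segment_apply ((exists_congr e).1 hz),
      h _ (add_le_of_nonpos_right s.2)]
  · rw [segment, segment, dif_neg hz, dif_neg (mt (exists_congr e).2 hz)]

lemma norm_segment_le {z : ℝ → Fin m → ℝ} {t C : ℝ} (hC : 0 ≤ C) (h : ∀ s ≤ t, ‖z s‖ ≤ C) :
    ‖segment z t‖ ≤ C := by
  by_cases hz : ∃ y : BC m, ∀ s : Set.Iic (0 : ℝ), y s = z (t + s)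
  · refine (BoundedContinuousFunction.norm_le hC).2 fun s => ?_
    rw [segment_apply hz]
    exact h _ (add_le_of_nonpos_right s.2)
  -- Here the segment is the default value 0; this is why 0 ≤ C is assumed.
  · rwa [segment, dif_neg hz, norm_zero]

lemma segment_eq_of_initial {z : ℝ → Fin m → ℝ} {x : BC m} (h : ∀ s : Set.Iic (0 : ℝ), z s = x s) :
    segment z 0 = x := by
  have hz : ∃ y : BC m, ∀ s : Set.Iic (0 : ℝ), y s = z (0 + s) := ⟨x, fun s => by rw [zero_add, h]⟩
  ext s : 1
  rw [segment_apply hz, zero_add, h]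

/-- A function continuous on `(-∞, T)` with bounded past, stopped at a time `T' < T`. -/
lemma admissible_stopped {z : ℝ → Fin m → ℝ} {x : BC m} {T T' : ℝ}
    (hz : ContinuousOn z (Set.Iio T)) (hx : ∀ s : Set.Iic (0 : ℝ), z s = x s) (hT : T' < T) :
    Admissible (fun t => z (min t T')) := by
  have hc : Continuous fun t => z (min t T') :=
    hz.comp_continuous (by fun_prop) fun t => (min_le_right t T').trans_lt hT
  refine ⟨hc, fun t => ?_⟩
  obtain ⟨C, hC⟩ := ((isCompact_Icc (a := (0 : ℝ)) (b := T')).image_of_continuousOn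
    (hz.mono fun τ hτ => lt_of_le_of_lt hτ.2 hT)).isBounded.exists_norm_le
  refine ⟨max C ‖x‖, fun s _ => ?_⟩
  rcases le_total (min s T') 0 with h | h
  · rw [hx ⟨_, h⟩]
    exact (x.norm_coe_le_norm _).trans (le_max_right _ _)
  · exact (hC _ ⟨_, ⟨h, min_le_right _ _⟩, rfl⟩).trans (le_max_left _ _)

/-- By currying, continuity into the compact-open topology follows from joint continuity in (p, t,
s). In the supremum norm it could fail, since the past need not be uniformly continuous. -/
lemma continuous_segment {P : Type*} [TopologicalSpace P] {z : P → ℝ → Fin m → ℝ}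
    (hz : Continuous fun q : P × ℝ => z q.1 q.2) (h : ∀ p, Admissible (z p)) :
    Continuous fun q : P × ℝ => ((segment (z q.1) q.2).toContinuousMap : X m) := by
  refine ContinuousMap.continuous_of_continuous_uncurry _ ?_
  have : Continuous fun q : (P × ℝ) × Set.Iic (0 : ℝ) => z q.1.1 (q.1.2 + q.2) :=
    hz.comp (by fun_prop : Continuous fun q : (P × ℝ) × Set.Iic (0 : ℝ) =>
      (q.1.1, q.1.2 + (q.2 : ℝ)))
  exact this.congr fun q => ((h q.1.1).segment_apply _ _).symm

variable {Ω : Type*} [TopologicalSpace Ω]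

lemma ContinuousOnBalls.continuousAt_comp {H : Ω → BC m → (Fin m → ℝ)} (hH : ContinuousOnBalls H)
    {P : Type*} [TopologicalSpace P] {p₀ : P} {ω : P → Ω} (hω : ContinuousAt ω p₀) {y : P → BC m}
    (hy : ContinuousAt (fun p => ((y p).toContinuousMap : X m)) p₀) {R : ℝ}
    (hR : ∀ᶠ p in 𝓝 p₀, ‖y p‖ ≤ R) : ContinuousAt (fun p => H (ω p) (y p)) p₀ := by
  have hR0 : 0 ≤ R := (norm_nonneg _).trans hR.self_of_nhds
  have hpos : 0 < R + 1 := by linarith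
  classical
  -- The norm bound holds only near p₀, so y is replaced by 0 where it leaves the ball; this does
  -- not change the germ at p₀.
  let y' : P → Ball m (R + 1) := fun p =>
    if h : ‖y p‖ ≤ R + 1 then ⟨y p, h⟩ else ⟨0, by simpa using hpos.le⟩
  have hy' : ∀ᶠ p in 𝓝 p₀, (y' p).1 = y p := hR.mono fun p hp => by
    have : y' p = ⟨y p, hp.trans (by linarith)⟩ := dif_pos _
    rw [this]
  have hc : ContinuousAt y' p₀ := by
    rw [ContinuousAt, nhds_induced, tendsto_comap_iff]
    rw [hy'.self_of_nhds]
    exact Tendsto.congr' (hy'.mono fun p hp => by simp only [Function.comp, hp]) hy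
  have := (hH _ hpos).continuousAt.comp (hω.prodMk hc)
  exact this.congr (hy'.mono fun p hp => by simp only [Function.comp, hp])

lemma ContinuousOnBalls.continuous_comp_segment {H : Ω → BC m → (Fin m → ℝ)}
    (hH : ContinuousOnBalls H) (σ : Flow ℝ Ω) (ω : Ω) {z : ℝ → Fin m → ℝ} (hz : Admissible z) :
    Continuous fun t => H (σ t ω) (segment z t) := by
  refine continuous_iff_continuousAt.2 fun t => ?_
  obtain ⟨C, hC⟩ := hz.bounded (t + 1)
  refine hH.continuousAt_comp (R := C) (ω := fun t => σ t ω)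
    (σ.continuous continuous_id continuous_const).continuousAt ?_ ?_
  · exact ((continuous_segment (P := Unit) (z := fun _ => z) (hz.continuous.comp continuous_snd)
      fun _ => hz).comp (by fun_prop : Continuous fun t : ℝ => ((), t))).continuousAt
  · filter_upwards [eventually_lt_nhds (lt_add_one t)] with s hs
    exact norm_segment_le ((norm_nonneg _).trans (hC t (by linarith))) fun τ hτ => hC τ (by linarith)

end Segments

/-! ### Weighted a priori estimate and comparison with approximate solutions -/

section Comparison

variable {m : ℕ} {Ω : Type*}

/-- `D` differs little from the evaluation at `0` on functions with exponential decay of rate `l`. -/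
def DecayBound (D : Ω → BC m →L[ℝ] (Fin m → ℝ)) (l : ℝ) : Prop :=
  ∀ (ω : Ω) (y : BC m) (M : ℝ),
    (∀ s : Set.Iic (0 : ℝ), ‖y s‖ ≤ M * Real.exp (l * (s : ℝ))) → ‖y zeroPt - D ω y‖ ≤ M / 4

/-- Shifting time by t multiplies the weight by e^{lt}, so a bound M e^{ls} up to time t becomes the
decay condition with constant M e^{lt}. -/
lemma DecayBound.segment {D : Ω → BC m →L[ℝ] (Fin m → ℝ)} {l : ℝ} (hD : DecayBound D l)
    {η : ℝ → Fin m → ℝ} (hη : Admissible η) {t M : ℝ}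
    (h : ∀ s ≤ t, ‖η s‖ ≤ M * Real.exp (l * s)) (ω : Ω) :
    ‖η t - D ω (segment η t)‖ ≤ M * Real.exp (l * t) / 4 := by
  rw [← hη.segment_zeroPt t]
  refine hD ω _ _ fun s => ?_
  rw [hη.segment_apply, mul_assoc, ← Real.exp_add, ← mul_add]
  exact h _ (add_le_of_nonpos_right s.2)

lemma norm_segment_le_exp {η : ℝ → Fin m → ℝ} {t M l : ℝ} (hM : 0 ≤ M) (hl : 0 ≤ l)
    (h : ∀ s ≤ t, ‖η s‖ ≤ M * Real.exp (l * s)) :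
    ‖segment η t‖ ≤ M * Real.exp (l * t) :=
  norm_segment_le (by positivity) fun s hs => (h s hs).trans (by gcongr)

/-- Integration gains a factor 1/l in the weighted norm; with l ≥ 4L this absorbs the Lipschitz
constant of G. -/
lemma norm_integral_le_exp {E : Type*} [NormedAddCommGroup E] [NormedSpace ℝ E] {f : ℝ → E}
    {K l t : ℝ} (hK : 0 ≤ K) (hl : 0 < l) (ht : 0 ≤ t)
    (h : ∀ s ∈ Set.Icc 0 t, ‖f s‖ ≤ K * Real.exp (l * s)) :
    ‖∫ s in (0 : ℝ)..t, f s‖ ≤ K / l * Real.exp (l * t) := by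
  have hint : ∫ s in (0 : ℝ)..t, K * Real.exp (l * s) = K / l * Real.exp (l * t) - K / l := by
    rw [intervalIntegral.integral_eq_sub_of_hasDerivAt (f := fun s => K / l * Real.exp (l * s))
      (fun s _ => ?_) (Continuous.intervalIntegrable (by fun_prop) _ _)]
    · simp
    · have := (((hasDerivAt_id s).const_mul l).exp).const_mul (K / l)
      refine this.congr_deriv ?_
      field_simp
      simp
  refine (intervalIntegral.norm_integral_le_of_norm_le ht (.of_forall fun s hs => h s ⟨hs.1.le, hs.2⟩)
    (Continuous.intervalIntegrable (by fun_prop) _ _)).trans ?_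
  rw [hint]
  have : 0 ≤ K / l := by positivity
  linarith

/-- The a priori estimate for functions vanishing on `(-∞, 0]`. -/
theorem norm_le_of_decayBound {D : Ω → BC m →L[ℝ] (Fin m → ℝ)} {l : ℝ} (hD : DecayBound D l)
    (hl : 0 ≤ l) {η : ℝ → Fin m → ℝ} (hη : Admissible η) (h0 : ∀ s ≤ 0, η s = 0) {T κ : ℝ}
    (ω : ℝ → Ω)
    (h : ∀ t ∈ Set.Icc 0 T, ∀ M, 0 ≤ M → (∀ s ∈ Set.Icc 0 t, ‖segment η s‖ ≤ M * Real.exp (l * s)) →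
      ‖D (ω t) (segment η t)‖ ≤ κ + M * Real.exp (l * t) / 4) :
    ∀ t ∈ Set.Icc 0 T, ‖η t‖ ≤ 2 * κ * Real.exp (l * t) := by
  intro t ht
  have hη' := hη.continuous
  -- At a maximum τ of the weighted norm, M e^{lτ} = ‖η(τ)‖, so the two errors M e^{lτ}/4 together
  -- are half of ‖η(τ)‖ and are absorbed: ‖η(τ)‖ ≤ 2κ.
  obtain ⟨τ, hτ, hmax⟩ := (isCompact_Icc (a := (0 : ℝ)) (b := T)).exists_isMaxOn ⟨t, ht⟩
    (f := fun s => ‖η s‖ * Real.exp (-(l * s))) (by fun_prop)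
  set M := ‖η τ‖ * Real.exp (-(l * τ)) with hM
  have hM0 : 0 ≤ M := by positivity
  have hbd : ∀ s ≤ T, ‖η s‖ ≤ M * Real.exp (l * s) := fun s hs => by
    rcases le_total s 0 with h | h
    · rw [h0 s h, norm_zero]; positivity
    · have : ‖η s‖ * Real.exp (-(l * s)) ≤ M := hmax ⟨h, hs⟩
      calc ‖η s‖ = ‖η s‖ * Real.exp (-(l * s)) * Real.exp (l * s) := by
            rw [mul_assoc, ← Real.exp_add]; simp
        _ ≤ _ := by gcongr
  have hMτ : M * Real.exp (l * τ) = ‖η τ‖ := by rw [hM, mul_assoc, ← Real.exp_add]; simp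
  have h1 := hD.segment hη (t := τ) (fun s hs => hbd s (hs.trans hτ.2)) (ω τ)
  have h2 := h τ hτ M hM0 fun s hs => norm_segment_le_exp hM0 hl fun s' hs' =>
    hbd s' (hs'.trans (hs.2.trans hτ.2))
  have h3 : ‖η τ‖ ≤ ‖η τ - D (ω τ) (segment η τ)‖ + ‖D (ω τ) (segment η τ)‖ := by
    simpa using norm_add_le (η τ - D (ω τ) (segment η τ)) (D (ω τ) (segment η τ))
  rw [hMτ] at h1 h2
  have h4 : ‖η τ‖ ≤ 2 * κ := by linarith
  have h5 : M ≤ 2 * κ := by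
    refine (mul_le_of_le_one_right (norm_nonneg _) (Real.exp_le_one_iff.2 ?_)).trans h4
    have := mul_nonneg hl hτ.1
    linarith
  exact (hbd t ht.2).trans (by gcongr)

variable [TopologicalSpace Ω]

/-- A solution is close to every approximate solution with the same initial datum. -/
theorem norm_sub_le_of_approximate {σ : Flow ℝ Ω} {D : Ω → BC m →L[ℝ] (Fin m → ℝ)}
    {G : Ω → BC m → (Fin m → ℝ)} {l L R : ℝ} (hD : DecayBound D l) (hl : 0 < l) (hL : 4 * L ≤ l)
    (hL0 : 0 ≤ L) (hGc : ContinuousOnBalls G)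
    (hG : ∀ ω x y, ‖x‖ ≤ R → ‖y‖ ≤ R → ‖G ω x - G ω y‖ ≤ L * ‖x - y‖)
    {z w : ℝ → Fin m → ℝ} (hz : Admissible z) (hw : Admissible w) (h0 : ∀ s ≤ 0, z s = w s)
    {ω : Ω} {T κ : ℝ} {a : Fin m → ℝ}
    (hzR : ∀ s ∈ Set.Icc 0 T, ‖segment z s‖ ≤ R) (hwR : ∀ s ∈ Set.Icc 0 T, ‖segment w s‖ ≤ R)
    (hzeq : ∀ t ∈ Set.Icc 0 T,
      D (σ t ω) (segment z t) = a + ∫ s in (0 : ℝ)..t, G (σ s ω) (segment z s))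
    (hweq : ∀ t ∈ Set.Icc 0 T,
      ‖D (σ t ω) (segment w t) - (a + ∫ s in (0 : ℝ)..t, G (σ s ω) (segment w s))‖ ≤ κ) :
    ∀ t ∈ Set.Icc 0 T, ‖z t - w t‖ ≤ 2 * κ * Real.exp (l * t) := by
  refine norm_le_of_decayBound hD hl.le (hz.sub hw) (fun s hs => by rw [h0 s hs, sub_self])
    (fun t => σ t ω) fun t ht M hM hMs => ?_
  have hi : ‖∫ s in (0 : ℝ)..t, (G (σ s ω) (segment z s) - G (σ s ω) (segment w s))‖
      ≤ L * M / l * Real.exp (l * t) := by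
    refine norm_integral_le_exp (by positivity) hl ht.1 fun s hs => ?_
    have hsT : s ∈ Set.Icc 0 T := ⟨hs.1, hs.2.trans ht.2⟩
    refine (hG _ _ _ (hzR s hsT) (hwR s hsT)).trans ?_
    rw [← hz.segment_sub hw, mul_assoc]
    exact mul_le_mul_of_nonneg_left (hMs s hs) hL0
  have hLl : L * M / l * Real.exp (l * t) ≤ M * Real.exp (l * t) / 4 := by
    rw [div_mul_eq_mul_div, div_le_div_iff₀ hl (by norm_num)]
    have : 0 ≤ M * Real.exp (l * t) := by positivity
    nlinarith
  rw [intervalIntegral.integral_sub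
    ((hGc.continuous_comp_segment σ ω hz).intervalIntegrable _ _)
    ((hGc.continuous_comp_segment σ ω hw).intervalIntegrable _ _)] at hi
  rw [hz.segment_sub hw, map_sub, hzeq t ht]
  calc _ = ‖-(D (σ t ω) (segment w t) - (a + ∫ s in (0 : ℝ)..t, G (σ s ω) (segment w s)))
        + ((∫ s in (0 : ℝ)..t, G (σ s ω) (segment z s))
          - ∫ s in (0 : ℝ)..t, G (σ s ω) (segment w s))‖ := by congr 1; abel
    _ ≤ κ + M * Real.exp (l * t) / 4 := by
      refine norm_add_le_of_le ?_ (hi.trans hLl)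
      rw [norm_neg]
      exact hweq t ht

end Comparison

/-! ### Global solutions for a bounded, globally Lipschitz nonlinearity -/

section GlobalExistence

variable {m : ℕ}

/-- The extension of `x` to the real line by the constant `x 0`. -/
def extend (x : BC m) (t : ℝ) : Fin m → ℝ := x ⟨min t 0, min_le_right t 0⟩

lemma extend_of_nonpos (x : BC m) (s : Set.Iic (0 : ℝ)) : extend x s = x s := by
  have : (⟨min (s : ℝ) 0, mem_Iic.2 (min_le_right _ _)⟩ : Set.Iic (0 : ℝ)) = s :=
    Subtype.ext (min_eq_left s.2)
  rw [extend, this]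

lemma norm_extend_le (x : BC m) (t : ℝ) : ‖extend x t‖ ≤ ‖x‖ := x.norm_coe_le_norm _

lemma admissible_extend (x : BC m) : Admissible (extend x) where
  continuous := x.continuous.comp (by fun_prop)
  bounded _ := ⟨‖x‖, fun s _ => norm_extend_le x s⟩

lemma continuous_extend (r : ℝ) : Continuous fun q : Ball m r × ℝ => extend q.1.1 q.2 := by
  have : LocallyCompactSpace (Set.Iic (0 : ℝ)) := isClosed_Iic.locallyCompactSpace
  have h1 : Continuous fun x : Ball m r => (x.1.toContinuousMap : X m) := continuous_induced_dom
  exact (h1.comp continuous_fst).eval (Continuous.subtype_mk (by fun_prop) fun q : Ball m r × ℝ =>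
    mem_Iic.2 (min_le_right q.2 0))

/-- Multiplication of a bounded function by an exponential. -/
def weighted (l : ℝ) (v : ℝ →ᵇ (Fin m → ℝ)) (t : ℝ) : Fin m → ℝ := Real.exp (l * t) • v t

lemma norm_weighted_le (l : ℝ) (v : ℝ →ᵇ (Fin m → ℝ)) (t : ℝ) :
    ‖weighted l v t‖ ≤ ‖v‖ * Real.exp (l * t) := by
  rw [weighted, norm_smul, Real.norm_eq_abs, Real.abs_exp, mul_comm]
  gcongr
  exact v.norm_coe_le_norm t

lemma admissible_weighted {l : ℝ} (hl : 0 ≤ l) (v : ℝ →ᵇ (Fin m → ℝ)) :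
    Admissible (weighted l v) where
  continuous := by unfold weighted; fun_prop
  bounded t := ⟨‖v‖ * Real.exp (l * t), fun s hs => (norm_weighted_le l v s).trans (by gcongr)⟩

lemma weighted_sub (l : ℝ) (v w : ℝ →ᵇ (Fin m → ℝ)) :
    weighted l (v - w) = fun t => weighted l v t - weighted l w t := by
  ext t : 1
  simp [weighted, smul_sub]

/-- The function extending `x` with perturbation `v` (weighted). -/
def candidate (l : ℝ) (x : BC m) (v : ℝ →ᵇ (Fin m → ℝ)) (t : ℝ) : Fin m → ℝ :=
  extend x t + weighted l v t

lemma admissible_candidate {l : ℝ} (hl : 0 ≤ l) (x : BC m) (v : ℝ →ᵇ (Fin m → ℝ)) :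
    Admissible (candidate l x v) := (admissible_extend x).add (admissible_weighted hl v)

variable {Ω : Type*} [TopologicalSpace Ω]

/-- The right-hand side of the fixed point equation of the integrated problem. -/
def picard (σ : Flow ℝ Ω) (D : Ω → BC m →L[ℝ] (Fin m → ℝ)) (G : Ω → BC m → (Fin m → ℝ)) (l : ℝ)
    (ω : Ω) (x : BC m) (v : ℝ →ᵇ (Fin m → ℝ)) (t : ℝ) : Fin m → ℝ :=
  weighted l v t - D (σ t ω) (segment (candidate l x v) t) +
    (D ω x + ∫ s in (0 : ℝ)..t, G (σ s ω) (segment (candidate l x v) s))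

variable {σ : Flow ℝ Ω} {D : Ω → BC m →L[ℝ] (Fin m → ℝ)} {G : Ω → BC m → (Fin m → ℝ)}

lemma continuous_picard (hDc : ContinuousOnBalls fun ω x => D ω x) (hGc : ContinuousOnBalls G)
    {l : ℝ} (hl : 0 ≤ l) (ω : Ω) (x : BC m) (v : ℝ →ᵇ (Fin m → ℝ)) :
    Continuous (picard σ D G l ω x v) := by
  have hz := admissible_candidate hl x v
  refine ((admissible_weighted hl v).continuous.sub
    (hDc.continuous_comp_segment σ ω hz)).add (continuous_const.add ?_)
  exact intervalIntegral.continuous_primitive (fun a b =>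
    (hGc.continuous_comp_segment σ ω hz).intervalIntegrable a b) 0

lemma norm_picard_le {l K B : ℝ} (hD : DecayBound D l) (hl : 0 < l) (hK : ∀ ω, ‖D ω‖ ≤ K)
    (hK0 : 0 ≤ K) (hB : ∀ ω x, ‖G ω x‖ ≤ B) (hB0 : 0 ≤ B) (ω : Ω) (x : BC m)
    (v : ℝ →ᵇ (Fin m → ℝ)) {t : ℝ} (ht : 0 ≤ t) :
    ‖picard σ D G l ω x v t‖ ≤ (‖v‖ / 4 + 2 * (K * ‖x‖) + B / l) * Real.exp (l * t) := by
  have hη := admissible_weighted hl.le v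
  have h1 := hD.segment hη (t := t) (fun s _ => norm_weighted_le l v s) (σ t ω)
  have hD' : ∀ ω (y : BC m), ‖y‖ ≤ ‖x‖ → ‖D ω y‖ ≤ K * ‖x‖ := fun ω y hy =>
    (D ω).le_of_opNorm_le_of_le (hK ω) hy
  have h2 := hD' (σ t ω) (segment (extend x) t)
    (norm_segment_le (norm_nonneg _) fun s _ => norm_extend_le x s)
  have h3 := hD' ω x le_rfl
  have hexp : ∀ s, 0 ≤ s → 1 ≤ Real.exp (l * s) := fun s hs => Real.one_le_exp (by positivity)
  have h4 : ‖∫ s in (0 : ℝ)..t, G (σ s ω) (segment (candidate l x v) s)‖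
      ≤ B / l * Real.exp (l * t) := norm_integral_le_exp hB0 hl ht fun s hs =>
    (hB _ _).trans (le_mul_of_one_le_right hB0 (hexp s hs.1))
  -- The decay estimate applies only to the weighted part; the extension of x need not decay at −∞
  -- and is controlled by the operator norm of D.
  have e : picard σ D G l ω x v t = (weighted l v t - D (σ t ω) (segment (weighted l v) t))
      + (-(D (σ t ω) (segment (extend x) t)) + (D ω x
        + ∫ s in (0 : ℝ)..t, G (σ s ω) (segment (candidate l x v) s))) := by
    have : segment (candidate l x v) t = segment (extend x) t + segment (weighted l v) t :=
      (admissible_extend x).segment_add hη t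
    rw [picard, this, map_add]
    abel
  rw [e]
  refine (norm_add_le_of_le h1 (norm_add_le_of_le ((norm_neg _).trans_le h2)
    (norm_add_le_of_le h3 h4))).trans ?_
  have : K * ‖x‖ ≤ K * ‖x‖ * Real.exp (l * t) :=
    le_mul_of_one_le_right (by positivity) (hexp t ht)
  linarith

/-- The ratio 1/2 is 1/4 from the decay estimate for D plus L/l ≤ 1/4 from the integral of G. -/
lemma norm_picard_sub_le {l L : ℝ} (hD : DecayBound D l) (hl : 0 < l) (hL : 4 * L ≤ l)
    (hL0 : 0 ≤ L) (hGc : ContinuousOnBalls G)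
    (hG : ∀ ω x y, ‖G ω x - G ω y‖ ≤ L * ‖x - y‖) (ω : Ω) (x : BC m)
    (v w : ℝ →ᵇ (Fin m → ℝ)) {t : ℝ} (ht : 0 ≤ t) :
    ‖picard σ D G l ω x v t - picard σ D G l ω x w t‖ ≤ ‖v - w‖ / 2 * Real.exp (l * t) := by
  have hv := admissible_candidate hl.le x v
  have hw := admissible_candidate hl.le x w
  have hη := admissible_weighted hl.le (v - w)
  have hseg : ∀ s, segment (candidate l x v) s - segment (candidate l x w) s
      = segment (weighted l (v - w)) s := fun s => by
    rw [← hv.segment_sub hw]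
    congr 1
    ext s : 1
    simp [candidate, weighted_sub]
  have h1 := hD.segment hη (t := t) (fun s _ => norm_weighted_le l (v - w) s) (σ t ω)
  have h2 : ‖∫ s in (0 : ℝ)..t, (G (σ s ω) (segment (candidate l x v) s)
      - G (σ s ω) (segment (candidate l x w) s))‖ ≤ L * ‖v - w‖ / l * Real.exp (l * t) := by
    refine norm_integral_le_exp (by positivity) hl ht fun s _ => (hG _ _ _).trans ?_
    rw [hseg, mul_assoc]
    exact mul_le_mul_of_nonneg_left (norm_segment_le_exp (norm_nonneg _) hl.le
      fun s' _ => norm_weighted_le l (v - w) s') hL0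
  have e : picard σ D G l ω x v t - picard σ D G l ω x w t
      = (weighted l (v - w) t - D (σ t ω) (segment (weighted l (v - w)) t))
        + ∫ s in (0 : ℝ)..t, (G (σ s ω) (segment (candidate l x v) s)
          - G (σ s ω) (segment (candidate l x w) s)) := by
    rw [intervalIntegral.integral_sub
      ((hGc.continuous_comp_segment σ ω hv).intervalIntegrable _ _)
      ((hGc.continuous_comp_segment σ ω hw).intervalIntegrable _ _), ← hseg, map_sub,
      weighted_sub]
    simp only [picard]
    abel
  rw [e]
  refine (norm_add_le_of_le h1 h2).trans ?_
  have h3 : L * ‖v - w‖ / l ≤ ‖v - w‖ / 4 := by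
    rw [div_le_div_iff₀ hl (by norm_num)]
    nlinarith [norm_nonneg (v - w)]
  have := mul_le_mul_of_nonneg_right h3 (Real.exp_pos (l * t)).le
  linarith

/-- Global existence for the integrated equation with a bounded Lipschitz nonlinearity. -/
theorem exists_global_solution {l L K B : ℝ} (hD : DecayBound D l) (hl : 0 < l) (hL : 4 * L ≤ l)
    (hL0 : 0 ≤ L) (hDc : ContinuousOnBalls fun ω x => D ω x) (hK : ∀ ω, ‖D ω‖ ≤ K) (hK0 : 0 ≤ K)
    (hGc : ContinuousOnBalls G) (hG : ∀ ω x y, ‖G ω x - G ω y‖ ≤ L * ‖x - y‖)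
    (hB : ∀ ω x, ‖G ω x‖ ≤ B) (hB0 : 0 ≤ B) (ω : Ω) (x : BC m) :
    ∃ z : ℝ → Fin m → ℝ, Admissible z ∧ (∀ s : Set.Iic (0 : ℝ), z s = x s) ∧
      ∀ t, 0 ≤ t → D (σ t ω) (segment z t)
        = D ω x + ∫ s in (0 : ℝ)..t, G (σ s ω) (segment z s) := by
  let S : Set (ℝ →ᵇ (Fin m → ℝ)) := {v | ∀ t ≤ 0, v t = 0}
  have hS : IsClosed S := by
    simp only [S, Set.ofPred_forall]
    exact isClosed_iInter fun t => isClosed_iInter fun _ =>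
      isClosed_eq (continuous_eval_const t) continuous_const
  have : CompleteSpace S := hS.completeSpace_coe
  have : Nonempty S := ⟨⟨0, fun _ _ => rfl⟩⟩
  have hinit : ∀ v ∈ S, ∀ s : Set.Iic (0 : ℝ), candidate l x v s = x s := fun v hv s => by
    simp [candidate, weighted, hv s s.2, extend_of_nonpos]
  -- The `max t 0` freezes the map at its value at time 0. For v in S that value is 0, because the
  -- segment at time 0 is x and the two terms D(ω, x) cancel; hence S is preserved.
  let N : (ℝ →ᵇ (Fin m → ℝ)) → ℝ → Fin m → ℝ := fun v t =>
    Real.exp (-(l * max t 0)) • picard σ D G l ω x v (max t 0)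
  have hexp : ∀ t, Real.exp (l * t) * Real.exp (-(l * t)) = 1 := fun t => by
    rw [← Real.exp_add]; simp
  have hNle : ∀ (p : Fin m → ℝ) (t C : ℝ), ‖p‖ ≤ C * Real.exp (l * t) →
      ‖Real.exp (-(l * t)) • p‖ ≤ C := fun p t C h => by
    rw [norm_smul, Real.norm_eq_abs, Real.abs_exp]
    calc _ ≤ Real.exp (-(l * t)) * (C * Real.exp (l * t)) := by gcongr
      _ = C * (Real.exp (l * t) * Real.exp (-(l * t))) := by ring
      _ = C := by rw [hexp, mul_one]
  have hNc : ∀ v, Continuous (N v) := fun v =>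
    (by fun_prop : Continuous fun t : ℝ => Real.exp (-(l * max t 0))).smul
      ((continuous_picard hDc hGc hl.le ω x v).comp (by fun_prop))
  have hN0 : ∀ v ∈ S, ∀ t ≤ 0, N v t = 0 := fun v hv t ht => by
    simp only [N, max_eq_right ht, picard, segment_eq_of_initial (hinit v hv), weighted,
      hv 0 le_rfl, Flow.map_zero_apply, intervalIntegral.integral_same]
    simp
  let Φ : S → S := fun v => ⟨BoundedContinuousFunction.ofNormedAddCommGroup (N v.1) (hNc v.1) _
    fun t => hNle _ _ _ (norm_picard_le hD hl hK hK0 hB hB0 ω x v.1 (le_max_right t 0)),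
    fun t ht => hN0 v.1 v.2 t ht⟩
  have hΦ : ContractingWith (1 / 2) Φ := by
    refine ⟨by rw [← NNReal.coe_lt_coe]; norm_num, LipschitzWith.of_dist_le_mul fun v w => ?_⟩
    rw [Subtype.dist_eq, Subtype.dist_eq, dist_eq_norm v.1]
    refine (BoundedContinuousFunction.dist_le (by positivity)).2 fun t => ?_
    rw [dist_eq_norm]
    change ‖N v.1 t - N w.1 t‖ ≤ _
    simp only [N]
    rw [← smul_sub]
    refine (hNle _ _ _ (norm_picard_sub_le hD hl hL hL0 hGc hG ω x v.1 w.1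
      (le_max_right t 0))).trans_eq ?_
    norm_num
    ring
  let v := hΦ.fixedPoint Φ
  have hv : ∀ t, v.1 t = N v.1 t := fun t =>
    congrArg (fun u : S => u.1 t) hΦ.fixedPoint_isFixedPt.symm
  refine ⟨candidate l x v.1, admissible_candidate hl.le x v.1, hinit v.1 v.2, fun t ht => ?_⟩
  have h1 : weighted l v.1 t = picard σ D G l ω x v.1 t := by
    rw [weighted, hv t]
    simp only [N]
    rw [max_eq_left ht, smul_smul, hexp, one_smul]
  rw [picard] at h1
  have h2 : weighted l v.1 t - D (σ t ω) (segment (candidate l x v.1) t)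
      + (D ω x + ∫ s in (0 : ℝ)..t, G (σ s ω) (segment (candidate l x v.1) s))
      - weighted l v.1 t = 0 := by rw [← h1, sub_self]
  rw [← sub_eq_zero, ← neg_eq_zero, ← h2]
  abel

end GlobalExistence

/-! ### Continuous dependence on time, ω and the initial function -/

section JointContinuity

variable {m : ℕ} {Ω : Type*} [TopologicalSpace Ω]

lemma continuous_comp_segment_family {H : Ω → BC m → (Fin m → ℝ)} (hH : ContinuousOnBalls H)
    (σ : Flow ℝ Ω) {P : Type*} [TopologicalSpace P] {ω : P → Ω} (hω : Continuous ω)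
    {z : P → ℝ → Fin m → ℝ} (hzc : Continuous fun q : P × ℝ => z q.1 q.2)
    (hz : ∀ p, Admissible (z p)) (hb : ∀ t, ∃ C, 0 ≤ C ∧ ∀ p, ∀ s ≤ t, ‖z p s‖ ≤ C) :
    Continuous fun q : P × ℝ => H (σ q.2 (ω q.1)) (segment (z q.1) q.2) := by
  refine continuous_iff_continuousAt.2 fun q₀ => ?_
  obtain ⟨C, hC0, hC⟩ := hb (q₀.2 + 1)
  refine hH.continuousAt_comp (R := C) (ω := fun q : P × ℝ => σ q.2 (ω q.1))
    (σ.continuous continuous_snd (hω.comp continuous_fst)).continuousAt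
    (continuous_segment hzc hz).continuousAt ?_
  filter_upwards [continuous_snd.continuousAt.eventually (eventually_lt_nhds (lt_add_one q₀.2))]
    with q hq
  exact norm_segment_le hC0 fun s hs => hC _ _ (hs.trans hq.le)

/-- Compactness of [0, T] turns joint continuity into closeness uniform in t, as in the tube lemma.
-/
lemma eventually_norm_sub_lt_of_continuous {P E : Type*} [TopologicalSpace P]
    [SeminormedAddCommGroup E] {f : P × ℝ → E} (hf : Continuous f) (p₀ : P) (T : ℝ) {ε : ℝ}
    (hε : 0 < ε) : ∀ᶠ p in 𝓝 p₀, ∀ t ∈ Set.Icc 0 T, ‖f (p, t) - f (p₀, t)‖ < ε := by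
  refine isCompact_Icc.eventually_forall_of_forall_eventually fun t _ => ?_
  have : Continuous fun q : P × ℝ => ‖f (q.1, q.2) - f (p₀, q.2)‖ := by fun_prop
  exact this.continuousAt.eventually (eventually_lt_nhds (by simpa using hε))

variable {σ : Flow ℝ Ω} {D : Ω → BC m →L[ℝ] (Fin m → ℝ)} {G : Ω → BC m → (Fin m → ℝ)}

/-- Global solutions depend continuously on time and on the initial data in a ball with the
compact-open topology. -/
theorem continuous_solution_family {l L r : ℝ} (hD : DecayBound D l) (hl : 0 < l)
    (hL : 4 * L ≤ l) (hL0 : 0 ≤ L) (hDc : ContinuousOnBalls fun ω x => D ω x)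
    (hGc : ContinuousOnBalls G) (hG : ∀ ω x y, ‖G ω x - G ω y‖ ≤ L * ‖x - y‖)
    {z : Ω × Ball m r → ℝ → Fin m → ℝ} (hz : ∀ p, Admissible (z p))
    (hinit : ∀ p, ∀ s : Set.Iic (0 : ℝ), z p s = p.2.1 s)
    (hsol : ∀ p t, 0 ≤ t → D (σ t p.1) (segment (z p) t)
      = D p.1 p.2.1 + ∫ s in (0 : ℝ)..t, G (σ s p.1) (segment (z p) s)) :
    Continuous fun q : (Ω × Ball m r) × ℝ => z q.1 q.2 := by
  refine continuous_iff_continuousAt.2 fun ⟨p₀, t₀⟩ => ?_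
  let η : ℝ → Fin m → ℝ := fun t => z p₀ t - extend p₀.2.1 t
  have hη : Admissible η := (hz p₀).sub (admissible_extend _)
  -- The comparison function has the past of p and the increment of the solution at p₀. Unlike `z`,
  -- it is visibly jointly continuous.
  let w : Ω × Ball m r → ℝ → Fin m → ℝ := fun p t => extend p.2.1 t + η t
  have hw : ∀ p, Admissible (w p) := fun p => (admissible_extend _).add hη
  have hwinit : ∀ p, ∀ s : Set.Iic (0 : ℝ), w p s = p.2.1 s := fun p s => by
    simp [w, η, extend_of_nonpos, hinit]
  have hwp₀ : w p₀ = z p₀ := by ext t : 1; simp [w, η]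
  have hwc : Continuous fun q : (Ω × Ball m r) × ℝ => w q.1 q.2 :=
    ((continuous_extend r).comp (by fun_prop : Continuous fun q : (Ω × Ball m r) × ℝ =>
      (q.1.2, q.2))).add (hη.continuous.comp continuous_snd)
  have hwb : ∀ t, ∃ C, 0 ≤ C ∧ ∀ p, ∀ s ≤ t, ‖w p s‖ ≤ C := fun t => by
    obtain ⟨C, hC⟩ := hη.bounded t
    have hC0 : 0 ≤ C := (norm_nonneg _).trans (hC t le_rfl)
    have hr0 : 0 ≤ r := (norm_nonneg _).trans p₀.2.2
    exact ⟨r + C, by positivity, fun p s hs =>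
      norm_add_le_of_le ((norm_extend_le _ _).trans p.2.2) (hC s hs)⟩
  have hd := continuous_comp_segment_family hDc σ continuous_fst hwc hw hwb
  have hg := continuous_comp_segment_family hGc σ continuous_fst hwc hw hwb
  have happrox : ∀ T κ : ℝ, 0 ≤ T → 0 < κ → ∀ᶠ p in 𝓝 p₀, ∀ t ∈ Set.Icc 0 T,
      ‖D (σ t p.1) (segment (w p) t)
        - (D p.1 p.2.1 + ∫ s in (0 : ℝ)..t, G (σ s p.1) (segment (w p) s))‖ ≤ κ := by
    intro T κ hT hκ
    -- The T + 2 shares of κ: one for D at time t, one for D at time 0, and at most T for the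
    -- integral of G.
    have hε : 0 < κ / (T + 2) := by positivity
    filter_upwards [eventually_norm_sub_lt_of_continuous hd p₀ T hε,
      eventually_norm_sub_lt_of_continuous hg p₀ T hε] with p hp hp' t ht
    have e0 := hsol p₀ t ht.1
    rw [← hwp₀] at e0
    have h0 := hp 0 ⟨le_rfl, hT⟩
    simp only [Flow.map_zero_apply, segment_eq_of_initial (hwinit _)] at h0
    have hi : ‖∫ s in (0 : ℝ)..t, (G (σ s p.1) (segment (w p) s)
        - G (σ s p₀.1) (segment (w p₀) s))‖ ≤ κ / (T + 2) * |t - 0| :=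
      intervalIntegral.norm_integral_le_of_norm_le_const fun s hs => by
        rw [uIoc_of_le ht.1] at hs
        exact (hp' s ⟨hs.1.le, hs.2.trans ht.2⟩).le
    rw [sub_zero, abs_of_nonneg ht.1, intervalIntegral.integral_sub
      ((hGc.continuous_comp_segment σ p.1 (hw p)).intervalIntegrable _ _)
      ((hGc.continuous_comp_segment σ p₀.1 (hw p₀)).intervalIntegrable _ _)] at hi
    calc _ = ‖(D (σ t p.1) (segment (w p) t) - D (σ t p₀.1) (segment (w p₀) t))
          - ((D p.1 p.2.1 - D p₀.1 p₀.2.1)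
            + ((∫ s in (0 : ℝ)..t, G (σ s p.1) (segment (w p) s))
              - ∫ s in (0 : ℝ)..t, G (σ s p₀.1) (segment (w p₀) s)))‖ := by
            rw [e0]; congr 1; abel
      _ ≤ κ / (T + 2) + (κ / (T + 2) + κ / (T + 2) * t) :=
          norm_sub_le_of_le (hp t ht).le (norm_add_le_of_le h0.le hi)
      _ ≤ κ / (T + 2) + (κ / (T + 2) + κ / (T + 2) * T) := by gcongr; exact ht.2
      _ = κ := by field_simp; ring
  have hdiff : Tendsto (fun q : (Ω × Ball m r) × ℝ => z q.1 q.2 - w q.1 q.2) (𝓝 (p₀, t₀))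
      (𝓝 0) := by
    refine Metric.tendsto_nhds.2 fun ε hε => ?_
    set T := |t₀| + 1 with hT
    have hT0 : 0 ≤ T := by positivity
    have hκ : 0 < ε / (4 * Real.exp (l * T)) := by positivity
    have ht : ∀ᶠ t in 𝓝 t₀, t < T := eventually_lt_nhds (by linarith [le_abs_self t₀])
    rw [nhds_prod_eq]
    filter_upwards [(happrox T _ hT0 hκ).prod_mk ht] with ⟨p, t⟩ ⟨hp, htT⟩
    simp only [dist_zero_right]
    rcases le_total t 0 with h | h
    · rw [hinit p ⟨t, h⟩, hwinit p ⟨t, h⟩, sub_self, norm_zero]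
      exact hε
    · obtain ⟨C, hC⟩ := (hz p).bounded T
      obtain ⟨C', hC'⟩ := (hw p).bounded T
      have hR0 : 0 ≤ max C C' := (norm_nonneg _).trans ((hC T le_rfl).trans (le_max_left _ _))
      have := norm_sub_le_of_approximate (σ := σ) (ω := p.1) (a := D p.1 p.2.1) (R := max C C')
        hD hl hL hL0 hGc (fun ω x y _ _ => hG ω x y) (hz p) (hw p)
        (fun s hs => (hinit p ⟨s, hs⟩).trans (hwinit p ⟨s, hs⟩).symm)
        (fun s hs => norm_segment_le hR0 fun s' hs' => (hC s' (hs'.trans hs.2)).trans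
          (le_max_left _ _))
        (fun s hs => norm_segment_le hR0 fun s' hs' => (hC' s' (hs'.trans hs.2)).trans
          (le_max_right _ _))
        (fun s hs => hsol p s hs.1) hp t ⟨h, htT.le⟩
      refine this.trans_lt ?_
      calc _ ≤ 2 * (ε / (4 * Real.exp (l * T))) * Real.exp (l * T) := by gcongr
        _ = ε / 2 := by field_simp; norm_num
        _ < ε := half_lt_self hε
  have := hdiff.add hwc.continuousAt.tendsto
  simp only [sub_add_cancel, zero_add, hwp₀] at this
  exact this

end JointContinuity

/-! ### Truncation of the nonlinearity -/

section Truncation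

variable {m : ℕ}

/-- Truncation of all coordinates to `[-R, R]`. -/
def clamp (R : ℝ) (v : Fin m → ℝ) : Fin m → ℝ := fun i => max (-R) (min R (v i))

lemma lipschitzWith_clamp (R : ℝ) : LipschitzWith 1 (clamp (m := m) R) := by
  refine LipschitzWith.of_dist_le_mul fun v w => ?_
  rw [NNReal.coe_one, one_mul]
  refine (dist_pi_le_iff dist_nonneg).2 fun i => le_trans ?_ (dist_le_pi_dist v w i)
  rw [Real.dist_eq, Real.dist_eq]
  rw [clamp, clamp, max_comm (-R), max_comm (-R)]
  refine (abs_max_sub_max_le_abs _ _ _).trans ?_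
  exact (abs_min_sub_min_le_max R (v i) R (w i)).trans (by simp)

lemma norm_clamp_le {R : ℝ} (hR : 0 ≤ R) (v : Fin m → ℝ) : ‖clamp R v‖ ≤ R :=
  (pi_norm_le_iff_of_nonneg hR).2 fun i => abs_le.2
    ⟨le_max_left _ _, max_le (by linarith) (min_le_left _ _)⟩

lemma clamp_eq_self {R : ℝ} {v : Fin m → ℝ} (h : ‖v‖ ≤ R) : clamp R v = v := by
  ext i
  have := abs_le.1 ((norm_le_pi_norm v i).trans h)
  rw [clamp, min_eq_right this.2, max_eq_right this.1]

/-- Pointwise truncation of a function. -/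
def clampBC (R : ℝ) (x : BC m) : BC m := x.comp (clamp R) (lipschitzWith_clamp R)

lemma norm_clampBC_le {R : ℝ} (hR : 0 ≤ R) (x : BC m) : ‖clampBC R x‖ ≤ R :=
  (BoundedContinuousFunction.norm_le hR).2 fun _ => norm_clamp_le hR _

lemma clampBC_eq_self {R : ℝ} {x : BC m} (h : ‖x‖ ≤ R) : clampBC R x = x := by
  ext s : 1
  exact clamp_eq_self ((x.norm_coe_le_norm s).trans h)

lemma norm_clampBC_sub_le (R : ℝ) (x y : BC m) : ‖clampBC R x - clampBC R y‖ ≤ ‖x - y‖ := by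
  rw [← dist_eq_norm, ← dist_eq_norm]
  refine (BoundedContinuousFunction.dist_le dist_nonneg).2 fun s => ?_
  refine ((lipschitzWith_clamp R).dist_le_mul _ _).trans ?_
  rw [NNReal.coe_one, one_mul]
  exact BoundedContinuousFunction.dist_coe_le_dist s

variable {Ω : Type*}

/-- The nonlinearity evaluated at the truncated argument. -/
def truncated (G : Ω → BC m → (Fin m → ℝ)) (R : ℝ) (ω : Ω) (x : BC m) : Fin m → ℝ :=
  G ω (clampBC R x)

lemma truncated_eq_self (G : Ω → BC m → (Fin m → ℝ)) {R : ℝ} {x : BC m} (h : ‖x‖ ≤ R) (ω : Ω) :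
    truncated G R ω x = G ω x := by rw [truncated, clampBC_eq_self h]

lemma LipschitzOnBalls.exists_nonneg {G : Ω → BC m → (Fin m → ℝ)} (hG : LipschitzOnBalls G) {R : ℝ}
    (hR : 0 < R) : ∃ L : ℝ, 0 ≤ L ∧ ∀ (ω : Ω) (x y : BC m), ‖x‖ ≤ R → ‖y‖ ≤ R →
      ‖G ω x - G ω y‖ ≤ L * ‖x - y‖ := by
  obtain ⟨L, hL⟩ := hG R hR
  exact ⟨max L 0, le_max_right _ _, fun ω x y hx hy => (hL ω x y hx hy).trans
    (mul_le_mul_of_nonneg_right (le_max_left _ _) (norm_nonneg _))⟩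

lemma LipschitzOnBalls.exists_truncated {G : Ω → BC m → (Fin m → ℝ)} (hG : LipschitzOnBalls G)
    {R : ℝ} (hR : 0 < R) : ∃ L : ℝ, 0 ≤ L ∧ ∀ (ω : Ω) (x y : BC m),
      ‖truncated G R ω x - truncated G R ω y‖ ≤ L * ‖x - y‖ := by
  obtain ⟨L, hL0, hL⟩ := hG.exists_nonneg hR
  exact ⟨L, hL0, fun ω x y => (hL ω _ _ (norm_clampBC_le hR.le x) (norm_clampBC_le hR.le y)).trans
    (mul_le_mul_of_nonneg_left (norm_clampBC_sub_le R x y) hL0)⟩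

variable [TopologicalSpace Ω]

lemma ContinuousOnBalls.truncated {G : Ω → BC m → (Fin m → ℝ)} (hG : ContinuousOnBalls G) {R : ℝ}
    (hR : 0 ≤ R) : ContinuousOnBalls (truncated G R) := fun r _ => by
  refine continuous_iff_continuousAt.2 fun p₀ => ?_
  refine hG.continuousAt_comp (R := R) (ω := fun p : Ω × Ball m r => p.1)
    (y := fun p => clampBC R p.2.1) continuous_fst.continuousAt ?_
    (.of_forall fun p => norm_clampBC_le hR _)
  have h1 : Continuous fun x : Ball m r => (x.1.toContinuousMap : X m) := continuous_induced_dom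
  exact ((ContinuousMap.continuous_postcomp
    (⟨clamp R, (lipschitzWith_clamp R).continuous⟩ : C(Fin m → ℝ, Fin m → ℝ))).comp
      (h1.comp continuous_snd)).continuousAt

/-- Bounded sets of BC are not compact, so the bound comes from the Lipschitz condition on the ball
together with compactness of Ω for G(·, 0). -/
lemma exists_bound_truncated [CompactSpace Ω] {G : Ω → BC m → (Fin m → ℝ)}
    (hc : Continuous fun p : Ω × BC m => G p.1 p.2) (hG : LipschitzOnBalls G) {R : ℝ} (hR : 0 < R) :
    ∃ B : ℝ, 0 ≤ B ∧ ∀ (ω : Ω) (x : BC m), ‖truncated G R ω x‖ ≤ B := by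
  obtain ⟨L, hL0, hL⟩ := hG.exists_nonneg hR
  have h0 : Continuous fun ω : Ω => G ω 0 := hc.comp (by fun_prop : Continuous fun ω : Ω =>
    (ω, (0 : BC m)))
  obtain ⟨C, hC⟩ := (isCompact_range h0).isBounded.exists_norm_le
  refine ⟨L * R + max C 0, by positivity, fun ω x => ?_⟩
  have h1 := hL ω (clampBC R x) 0 (norm_clampBC_le hR.le x) (by simpa using hR.le)
  have h2 : L * ‖clampBC R x - 0‖ ≤ L * R := by
    rw [sub_zero]
    exact mul_le_mul_of_nonneg_left (norm_clampBC_le hR.le x) hL0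
  have h3 := norm_add_le_of_le (h1.trans h2) ((hC _ ⟨ω, rfl⟩).trans (le_max_left C 0))
  rwa [sub_add_cancel] at h3

end Truncation

/-! ### Uniqueness, local existence and local families of solutions -/

section Solutions

variable {m : ℕ} {Ω : Type*} [TopologicalSpace Ω] {σ : Flow ℝ Ω}
  {D : Ω → BC m →L[ℝ] (Fin m → ℝ)} {G : Ω → BC m → (Fin m → ℝ)}

/-- Uniqueness for the integrated equation. -/
theorem eq_of_integral_equation (hD : ∃ l₀, ∀ l ≥ l₀, DecayBound D l)
    (hGc : ContinuousOnBalls G) (hG : LipschitzOnBalls G)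
    {z w : ℝ → Fin m → ℝ} (hz : Admissible z) (hw : Admissible w) (h0 : ∀ s ≤ 0, z s = w s)
    {ω : Ω} {T : ℝ} {a : Fin m → ℝ}
    (hzeq : ∀ t ∈ Set.Icc 0 T,
      D (σ t ω) (segment z t) = a + ∫ s in (0 : ℝ)..t, G (σ s ω) (segment z s))
    (hweq : ∀ t ∈ Set.Icc 0 T,
      D (σ t ω) (segment w t) = a + ∫ s in (0 : ℝ)..t, G (σ s ω) (segment w s)) :
    ∀ t ≤ T, z t = w t := by
  intro t ht
  rcases le_total t 0 with h | h
  · exact h0 t h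
  obtain ⟨C, hC⟩ := hz.bounded T
  obtain ⟨C', hC'⟩ := hw.bounded T
  have hR : 0 < max C C' + 1 :=
    (add_pos_of_nonneg_of_pos ((norm_nonneg _).trans ((hC T le_rfl).trans (le_max_left C C')))
      one_pos)
  obtain ⟨L, hL0, hL⟩ := hG.exists_nonneg hR
  obtain ⟨l₀, hl₀⟩ := hD
  -- Both functions are exact solutions in a common ball, so the comparison holds with error κ = 0.
  have := norm_sub_le_of_approximate (σ := σ) (κ := 0) (hl₀ (max l₀ (max (4 * L) 1))
    (le_max_left _ _)) (lt_max_of_lt_right (lt_max_of_lt_right one_pos))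
    ((le_max_left _ _).trans (le_max_right _ _)) hL0 hGc hL hz hw h0
    (fun s hs => norm_segment_le hR.le fun s' hs' => (hC s' (hs'.trans hs.2)).trans
      ((le_max_left _ _).trans (le_add_of_nonneg_right zero_le_one)))
    (fun s hs => norm_segment_le hR.le fun s' hs' => (hC' s' (hs'.trans hs.2)).trans
      ((le_max_right _ _).trans (le_add_of_nonneg_right zero_le_one)))
    hzeq (fun t ht => by rw [hweq t ht, sub_self, norm_zero]) t ⟨h, ht⟩
  rw [mul_zero, zero_mul] at this
  exact sub_eq_zero.1 (norm_le_zero_iff.1 this)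

/-- An admissible solution of the integrated truncated equation solves the original equation as
long as it stays in the ball where the truncation is inactive. -/
lemma isSolution_of_truncated (hGc : ContinuousOnBalls G) {ω : Ω} {x : BC m} {T R : ℝ} (hT : 0 < T)
    {z : ℝ → Fin m → ℝ} (hz : Admissible z) (hinit : ∀ s : Set.Iic (0 : ℝ), z s = x s)
    (hR : ∀ s < T, ‖z s‖ ≤ R)
    (heq : ∀ t, 0 ≤ t → D (σ t ω) (segment z t)
      = D ω x + ∫ s in (0 : ℝ)..t, truncated G R (σ s ω) (segment z s)) :
    IsSolution σ D G ω x T z where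
  pos := hT
  continuousOn := hz.continuous.continuousOn
  initial := hinit
  hasDeriv t ht := by
    have hR0 : 0 ≤ R := (norm_nonneg _).trans (hR 0 hT)
    have hc := (hGc.truncated hR0).continuous_comp_segment σ ω hz
    have hd := ((intervalIntegral.integral_hasDerivAt_right (hc.intervalIntegrable 0 t)
      (hc.stronglyMeasurableAtFilter _ _) hc.continuousAt).const_add (D ω x)).hasDerivWithinAt
        (s := Set.Ici 0)
    rw [truncated_eq_self G (norm_segment_le hR0 fun s hs => hR s (hs.trans_lt ht.2))] at hd
    exact hd.congr (fun τ hτ => heq τ hτ) (heq t ht.1)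

/-- A solution, stopped before the end of its interval of definition, solves the integrated
equation. -/
lemma IsSolution.integral_equation (hGc : ContinuousOnBalls G) {ω : Ω} {x : BC m} {T T' : ℝ}
    {z : ℝ → Fin m → ℝ} (hz : IsSolution σ D G ω x T z) (hT : T' < T) :
    ∀ t ∈ Set.Icc 0 T', D (σ t ω) (segment (fun t => z (min t T')) t)
      = D ω x + ∫ s in (0 : ℝ)..t, G (σ s ω) (segment (fun t => z (min t T')) s) := by
  intro t ht
  have hw := admissible_stopped hz.continuousOn hz.initial hT
  have hseg : ∀ s ≤ T', segment (fun t => z (min t T')) s = segment z s := fun s hs =>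
    segment_congr fun s' hs' => by rw [min_eq_left (hs'.trans hs)]
  -- Right derivatives suffice, which suits the one-sided derivative at 0. The integrand uses the
  -- stopped function, whose continuity on the whole line gives integrability.
  have hI := intervalIntegral.integral_eq_sub_of_hasDeriv_right
    (f := fun τ => D (σ τ ω) (segment z τ)) (a := 0) (b := t)
    (f' := fun s => G (σ s ω) (segment (fun t => z (min t T')) s)) ?_ ?_
    ((hGc.continuous_comp_segment σ ω hw).intervalIntegrable _ _)
  · rw [hI, hseg t ht.2, segment_eq_of_initial hz.initial, Flow.map_zero_apply]
    abel
  · rw [uIcc_of_le ht.1]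
    intro s hs
    exact (hz.hasDeriv s ⟨hs.1, (hs.2.trans ht.2).trans_lt hT⟩).continuousWithinAt.mono
      fun τ hτ => hτ.1
  · rw [min_eq_left ht.1, max_eq_right ht.1]
    intro s hs
    rw [hseg s (hs.2.le.trans ht.2)]
    exact (hz.hasDeriv s ⟨hs.1.le, (hs.2.le.trans ht.2).trans_lt hT⟩).mono
      fun τ hτ => hs.1.le.trans (le_of_lt hτ)

lemma IsSolution.stopped_initial {ω : Ω} {x : BC m} {T T' : ℝ} {z : ℝ → Fin m → ℝ}
    (hz : IsSolution σ D G ω x T z) (hT : 0 ≤ T') (s : Set.Iic (0 : ℝ)) :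
    z (min s T') = x s := by
  have hs : (s : ℝ) ≤ 0 := s.2
  rw [min_eq_left (hs.trans hT), hz.initial]

/-- Two solutions with the same initial datum coincide on their common interval of definition. -/
theorem IsSolution.unique (hD : ∃ l₀, ∀ l ≥ l₀, DecayBound D l) (hGc : ContinuousOnBalls G)
    (hG : LipschitzOnBalls G) {ω : Ω} {x : BC m} {T₁ T₂ : ℝ} {z₁ z₂ : ℝ → Fin m → ℝ}
    (h₁ : IsSolution σ D G ω x T₁ z₁) (h₂ : IsSolution σ D G ω x T₂ z₂) {t : ℝ} (ht₁ : t < T₁)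
    (ht₂ : t < T₂) : z₁ t = z₂ t := by
  rcases le_total t 0 with h | h
  · rw [h₁.initial ⟨t, h⟩, h₂.initial ⟨t, h⟩]
  have := eq_of_integral_equation (σ := σ) hD hGc hG
    (admissible_stopped h₁.continuousOn h₁.initial ht₁)
    (admissible_stopped h₂.continuousOn h₂.initial ht₂)
    (fun s hs => (h₁.stopped_initial h ⟨s, hs⟩).trans (h₂.stopped_initial h ⟨s, hs⟩).symm)
    (h₁.integral_equation hGc ht₁) (h₂.integral_equation hGc ht₂) t le_rfl
  simpa using this

/-- By uniqueness, the solution chosen in `solutionSegment` does not matter. -/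
lemma solutionSegment_eq (hD : ∃ l₀, ∀ l ≥ l₀, DecayBound D l) (hG : LipschitzOnBalls G)
    (hGc : ContinuousOnBalls G) {t : ℝ≥0} {ω : Ω} {x : BC m} {T : ℝ} {z : ℝ → Fin m → ℝ}
    (hz : IsSolution σ D G ω x T z) (ht : t < T) :
    solutionSegment σ D G t ω x = segment z t := by
  have h : IsDefinedAt σ D G t ω x := ⟨z, T, ht, hz⟩
  rw [solutionSegment, dif_pos h]
  obtain ⟨T', hT', hz'⟩ := h.choose_spec
  exact segment_congr fun s hs => hz'.unique hD hGc hG hz (hs.trans_lt hT') (hs.trans_lt ht)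

variable [CompactSpace Ω]

/-- The solutions of the truncated equation are global and depend continuously on the data. -/
theorem exists_truncated_family (hD : ∃ l₀, ∀ l ≥ l₀, DecayBound D l) (hD1 : Continuous D)
    (hDc : ContinuousOnBalls fun ω x => D ω x) (hc : Continuous fun p : Ω × BC m => G p.1 p.2)
    (hG : LipschitzOnBalls G) (hGc : ContinuousOnBalls G) {R : ℝ} (hR : 0 < R) (r : ℝ) :
    ∃ z : Ω × Ball m r → ℝ → Fin m → ℝ,
      (Continuous fun q : (Ω × Ball m r) × ℝ => z q.1 q.2) ∧ (∀ p, Admissible (z p)) ∧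
      (∀ p, ∀ s : Set.Iic (0 : ℝ), z p s = p.2.1 s) ∧
      ∀ p t, 0 ≤ t → D (σ t p.1) (segment (z p) t)
        = D p.1 p.2.1 + ∫ s in (0 : ℝ)..t, truncated G R (σ s p.1) (segment (z p) s) := by
  obtain ⟨L, hL0, hL⟩ := hG.exists_truncated hR
  obtain ⟨B, hB0, hB⟩ := exists_bound_truncated hc hG hR
  have hDn : Continuous fun ω => ‖D ω‖ :=
    (continuous_norm (E := BC m →L[ℝ] (Fin m → ℝ))).comp hD1
  obtain ⟨K, hK⟩ := (isCompact_range hDn).bddAbove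
  obtain ⟨l₀, hl₀⟩ := hD
  have hl := hl₀ (max l₀ (max (4 * L) 1)) (le_max_left _ _)
  have hlpos : 0 < max l₀ (max (4 * L) 1) := lt_max_of_lt_right (lt_max_of_lt_right one_pos)
  have hlL : 4 * L ≤ max l₀ (max (4 * L) 1) := (le_max_left _ _).trans (le_max_right _ _)
  have hTc := hGc.truncated hR.le
  choose z hz hinit hsol using fun p : Ω × Ball m r =>
    exists_global_solution (σ := σ) (K := max K 0) hl hlpos hlL hL0 hDc
      (fun ω => (hK ⟨ω, rfl⟩).trans (le_max_left _ _)) (le_max_right _ _) hTc hL hB hB0 p.1 p.2.1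
  exact ⟨z, continuous_solution_family hl hlpos hlL hL0 hDc hTc hL hz hinit hsol, hz, hinit, hsol⟩

/-- Near the initial data of a solution defined beyond `t`, there is a jointly continuous family of
solutions defined beyond `t`. -/
theorem exists_local_family (hD : ∃ l₀, ∀ l ≥ l₀, DecayBound D l) (hD1 : Continuous D)
    (hDc : ContinuousOnBalls fun ω x => D ω x) (hc : Continuous fun p : Ω × BC m => G p.1 p.2)
    (hG : LipschitzOnBalls G) (hGc : ContinuousOnBalls G) {r : ℝ} {t : ℝ} (ht : 0 ≤ t)
    {p₀ : Ω × Ball m r} {T : ℝ} (htT : t < T) {y : ℝ → Fin m → ℝ}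
    (hy : IsSolution σ D G p₀.1 p₀.2.1 T y) :
    ∃ (z : Ω × Ball m r → ℝ → Fin m → ℝ) (T' : ℝ), t < T' ∧
      (Continuous fun q : (Ω × Ball m r) × ℝ => z q.1 q.2) ∧ (∀ p, Admissible (z p)) ∧
      ∀ᶠ p in 𝓝 p₀, IsSolution σ D G p.1 p.2.1 T' (z p) := by
  obtain ⟨T', htT', hT'⟩ := exists_between htT
  have hT'0 : 0 ≤ T' := ht.trans htT'.le
  have hw := admissible_stopped hy.continuousOn hy.initial hT'
  obtain ⟨C, hC⟩ := hw.bounded T'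
  have hC0 : 0 ≤ C := (norm_nonneg _).trans (hC T' le_rfl)
  have hCR : C + 1 ≤ max C r + 1 := by gcongr; exact le_max_left _ _
  -- C bounds the given solution up to T', and the margin 1 leaves room for nearby ones. The r is
  -- for the pasts, which are close only on compact sets and are controlled by the ball alone.
  have hR : 0 < max C r + 1 := by linarith
  obtain ⟨z, hzc, hz, hinit, hsol⟩ :=
    exists_truncated_family (σ := σ) hD hD1 hDc hc hG hGc hR r
  refine ⟨z, T', htT', hzc, hz, ?_⟩
  have hwseg : ∀ s ≤ T', ‖segment (fun t => y (min t T')) s‖ ≤ max C r + 1 := fun s hs =>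
    norm_segment_le hR.le fun s' hs' => (hC s' (hs'.trans hs)).trans (by linarith)
  have htr : LipschitzOnBalls (truncated G (max C r + 1)) := fun _ _ => by
    obtain ⟨L, -, hL⟩ := hG.exists_truncated hR
    exact ⟨L, fun ω x y _ _ => hL ω x y⟩
  -- The given solution also solves the truncated equation up to T', so by uniqueness there it is
  -- the member of the family at p₀.
  have heq := eq_of_integral_equation (σ := σ) hD (hGc.truncated hR.le) htr (hz p₀) hw
    (fun s hs => (hinit p₀ ⟨s, hs⟩).trans (hy.stopped_initial hT'0 ⟨s, hs⟩).symm)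
    (T := T') (fun s hs => hsol p₀ s hs.1) (fun t ht => by
      rw [hy.integral_equation hGc hT' t ht]
      congr 1
      refine intervalIntegral.integral_congr fun s hs => ?_
      rw [uIcc_of_le ht.1] at hs
      exact (truncated_eq_self G (hwseg s (hs.2.trans ht.2)) _).symm)
  filter_upwards [eventually_norm_sub_lt_of_continuous hzc p₀ T' one_pos] with p hp
  refine isSolution_of_truncated hGc (ht.trans_lt htT') (hz p) (hinit p) (fun s hs => ?_) (hsol p)
  rcases le_total s 0 with h | h
  · rw [hinit p ⟨s, h⟩]
    refine ((p.2.1.norm_coe_le_norm _).trans p.2.2).trans ?_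
    linarith [le_max_right C r]
  · have h1 := hp s ⟨h, hs.le⟩
    have h2 : ‖z p₀ s‖ ≤ C := by rw [heq s hs.le]; exact hC s hs.le
    have h3 := norm_add_le_of_le h1.le h2
    rw [sub_add_cancel] at h3
    linarith

/-- Local existence. -/
theorem exists_isSolution (hD : ∃ l₀, ∀ l ≥ l₀, DecayBound D l) (hD1 : Continuous D)
    (hDc : ContinuousOnBalls fun ω x => D ω x) (hc : Continuous fun p : Ω × BC m => G p.1 p.2)
    (hG : LipschitzOnBalls G) (hGc : ContinuousOnBalls G) (ω : Ω) (x : BC m) :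
    ∃ (T : ℝ) (z : ℝ → Fin m → ℝ), IsSolution σ D G ω x T z := by
  have hR : 0 < ‖x‖ + 1 := by positivity
  obtain ⟨z, -, hz, hinit, hsol⟩ :=
    exists_truncated_family (σ := σ) hD hD1 hDc hc hG hGc hR ‖x‖
  let p : Ω × Ball m ‖x‖ := (ω, ⟨x, le_rfl⟩)
  have hneg : ∀ s ≤ 0, ‖z p s‖ ≤ ‖x‖ := fun s hs => by
    rw [hinit p ⟨s, hs⟩]
    exact x.norm_coe_le_norm _
  -- The past is bounded by ‖x‖, so by continuity the truncation at ‖x‖ + 1 stays inactive for a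
  -- short time.
  have hev : ∀ᶠ s in 𝓝 (0 : ℝ), ‖z p s‖ < ‖x‖ + 1 :=
    (hz p).continuous.norm.continuousAt.eventually
      (eventually_lt_nhds ((hneg 0 le_rfl).trans_lt (lt_add_one _)))
  obtain ⟨T, hT, h⟩ := Metric.eventually_nhds_iff.1 hev
  refine ⟨T, z p, isSolution_of_truncated hGc hT (hz p) (hinit p) (fun s hs => ?_) (hsol p)⟩
  rcases le_total s 0 with h0 | h0
  · exact (hneg s h0).trans (by linarith)
  · exact (h (by rwa [Real.dist_eq, sub_zero, abs_of_nonneg h0])).le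

end Solutions

end NeutralFDE

end

/-! ### The main theorem -/

theorem mainTheorem10 {Ω : Type*} [MetricSpace Ω] [CompactSpace Ω]
    (σ : Flow ℝ Ω) (hσ : NeutralFDE.IsMinimalFlow σ) (m : ℕ)
    (D : Ω → NeutralFDE.BC m →L[ℝ] (Fin m → ℝ))
    (G : Ω → NeutralFDE.BC m → (Fin m → ℝ))
    (hD1 : Continuous D)
    (hD2 : NeutralFDE.ContinuousOnBalls fun ω x => D ω x)
    (hD3 : ∀ ω : Ω, NeutralFDE.AtomicAtZero (D ω))
    (hD4 : NeutralFDE.IsStable σ D)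
    (hN1 : Continuous fun p : Ω × NeutralFDE.BC m => G p.1 p.2)
    (hN1' : NeutralFDE.LipschitzOnBalls G)
    (hN2 : NeutralFDE.ContinuousOnBalls G) :
    -- local existence and uniqueness
    (∀ (ω : Ω) (x : NeutralFDE.BC m),
      (∃ (T : ℝ) (z : ℝ → Fin m → ℝ), NeutralFDE.IsSolution σ D G ω x T z) ∧
      ∀ (T₁ T₂ : ℝ) (z₁ z₂ : ℝ → Fin m → ℝ),
        NeutralFDE.IsSolution σ D G ω x T₁ z₁ → NeutralFDE.IsSolution σ D G ω x T₂ z₂ →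
          ∀ t : ℝ, t < T₁ → t < T₂ → z₁ t = z₂ t) ∧
    -- the local skew-product map is defined on an open set and continuous there, when the balls
    -- of initial data and the values of `u` carry the compact-open topology
    (∀ r : ℝ, 0 ≤ r →
      IsOpen {p : ℝ≥0 × Ω × NeutralFDE.Ball m r |
        NeutralFDE.IsDefinedAt σ D G p.1 p.2.1 p.2.2.1} ∧
      ContinuousOn
        (fun p : ℝ≥0 × Ω × NeutralFDE.Ball m r =>
          ((σ p.1 p.2.1,
            (NeutralFDE.solutionSegment σ D G p.1 p.2.1 p.2.2.1).toContinuousMap) :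
            Ω × NeutralFDE.X m))
        {p : ℝ≥0 × Ω × NeutralFDE.Ball m r |
          NeutralFDE.IsDefinedAt σ D G p.1 p.2.1 p.2.2.1}) := by
  have hD : ∃ l₀, ∀ l ≥ l₀, NeutralFDE.DecayBound D l :=
    NeutralFDE.exists_uniform_exp_bound hD1 hD2 hD3
  refine ⟨fun ω x => ⟨NeutralFDE.exists_isSolution hD hD1 hD2 hN1 hN1' hN2 ω x,
    fun T₁ T₂ z₁ z₂ h₁ h₂ t ht₁ ht₂ => h₁.unique hD hN2 hN1' h₂ ht₁ ht₂⟩, fun r _ => ?_⟩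
  -- One family of functions, continuous everywhere, gives genuine solutions past the required time
  -- for all data near q₀. This gives openness at once, and continuity because u agrees near q₀ with
  -- the segments of that family.
  have key : ∀ q₀ : ℝ≥0 × Ω × NeutralFDE.Ball m r,
      NeutralFDE.IsDefinedAt σ D G q₀.1 q₀.2.1 q₀.2.2.1 →
      ∃ z : Ω × NeutralFDE.Ball m r → ℝ → Fin m → ℝ,
        (Continuous fun q : (Ω × NeutralFDE.Ball m r) × ℝ => z q.1 q.2) ∧
        (∀ p, NeutralFDE.Admissible (z p)) ∧
        ∀ᶠ q in 𝓝 q₀, ∃ T : ℝ, q.1 < T ∧ NeutralFDE.IsSolution σ D G q.2.1 q.2.2.1 T (z q.2) := by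
    rintro ⟨t, p₀⟩ ⟨y, T, htT, hy⟩
    obtain ⟨z, T', hT', hzc, hz, hs⟩ :=
      NeutralFDE.exists_local_family hD hD1 hD2 hN1 hN1' hN2 t.2 htT hy
    refine ⟨z, hzc, hz, ?_⟩
    have h1 : ∀ᶠ s : ℝ≥0 in 𝓝 t, (s : ℝ) < T' :=
      NNReal.continuous_coe.continuousAt.eventually (eventually_lt_nhds hT')
    rw [nhds_prod_eq]
    filter_upwards [h1.prod_mk hs] with q hq
    exact ⟨T', hq.1, hq.2⟩
  refine ⟨isOpen_iff_mem_nhds.2 fun q₀ hq₀ => ?_, fun q₀ hq₀ => ContinuousAt.continuousWithinAt ?_⟩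
  · obtain ⟨z, -, -, h⟩ := key q₀ hq₀
    filter_upwards [h] with q ⟨T, hT, hs⟩
    exact ⟨z q.2, T, hT, hs⟩
  · obtain ⟨z, hzc, hz, h⟩ := key q₀ hq₀
    refine (σ.continuous (NNReal.continuous_coe.comp continuous_fst)
      (continuous_fst.comp continuous_snd)).continuousAt.prodMk ?_
    have hc : Continuous fun q : ℝ≥0 × Ω × NeutralFDE.Ball m r =>
        ((NeutralFDE.segment (z q.2) q.1).toContinuousMap : NeutralFDE.X m) :=
      (NeutralFDE.continuous_segment hzc hz).comp
        (continuous_snd.prodMk (NNReal.continuous_coe.comp continuous_fst))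
    refine hc.continuousAt.congr ?_
    filter_upwards [h] with q ⟨T, hT, hs⟩
    rw [NeutralFDE.solutionSegment_eq hD hN1' hN2 hs hT]
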